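/- **Setting.** Let $\mathcal U$ be a set of pages and $k\ge 1$ the cache size. A finite request sequence $\Gamma=(p_1,\dots,p_n)$ is served starting from an empty cache. If $p_t$ is not in the cache at time $t$, a cache miss occurs and $p_t$ is fetched, other pages being evicted so that at most $k$ pages are held. $\mathrm{OPT}=\mathrm{OPT}(\Gamma)$ is the least number of cache misses of an offline solution. At time $t$ the algorithm may query an oracle for any page $p$ in its cache, and receives a predicted time $\tau_{p,t}\in\mathbb N$ of the next request for $p$ after time $t$. The oracle $(\tau_{p,t})_{p,t}$ may be random with an arbitrary joint law, but is independent of the random choices of the algorithm. Let $a_{p,t}$ be the actual time of the first request for $p$ after time $t$ ($a_{p,t}=n+1$ if there is none), and let $\eta=\sum_{(p,t)\in Q}|\tau_{p,t}-a_{p,t}|$, where $Q$ is the set of queries made. **Algorithm.** AdaptiveQuery-$b$ with a switch is the following marking algorithm. On a hit, the requested page is marked. On a miss with fewer than $k$ pages in the cache, the page is fetched and marked. On a miss for $p$ with a full cache: if all pages in the cache are marked, a new phase begins and all of them are unmarked; then an unmarked page is evicted, and $p$ is fetched and marked. The position of a page in its eviction chain is $0$ if it has not been evicted in the current phase, and a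 page evicted to serve $p$ gets the position of $p$ plus one. If the position of $p$ is at most $\log_2 k$, the algorithm samples $b$ unmarked pages in the cache uniformly at random without replacement (all of them if there are fewer than $b$), queries them, and evicts a sampled page with the largest predicted time (ties broken uniformly at random). If the position of $p$ exceeds $\log_2 k$, it makes no query and evicts a uniformly random unmarked page. **Theorem.** For all integers $k\ge 1$ and $b\ge 1$, this is a randomized online caching algorithm that makes at most $b$ queries at each cache miss (and none at hits). There is an absolute constant $c>0$ such that, for all $\mathcal U$, $k\ge1$, $b\ge1$, every request sequence $\Gamma$ and every oracle, $$\mathbb E[\mathrm{cost}(\Gamma)]\;\le\; c\cdot\min\Bigl\{1+\log_{b+1}k+\frac{\mathbb E[\eta]}{\mathrm{OPT}},\;1+\log_2 k\Bigr\}\cdot \mathrm{OPT},$$ where $\mathrm{cost}(\Gamma)$ is the number of cache misses of the algorithm (for $\mathrm{OPT}=0$, that is, for empty $\Gamma$, the right-hand side is read as $0$). In particular, for $1\le b<k$ the algorithm is $O(\min\{\log_{b+1}k+\mathbb E[\eta]/\mathrm{OPT},\log k\})$-competitive. -/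

import Mathlib

open scoped ENNReal

universe u

namespace Caching

/-! ### Request sequences, caches and the offline optimum

Pages are the elements of a type `U`.  A request sequence is a list `Γ = [p₁, …, pₙ]`; the request
`p_t` arrives at time `t`, so times start at `1`. -/

section Offline

variable {U : Type u} [DecidableEq U]

/-- With cache capacity `k`, a request to `p` may change the cache contents from `C` to `C'`:
the page `p` is present afterwards, no page other than `p` is fetched, and at most `k` pages are
held. -/
def Serves (k : ℕ) (C : Finset U) (p : U) (C' : Finset U) : Prop :=
  p ∈ C' ∧ C' ⊆ insert p C ∧ C'.card ≤ k

/-- `C` is an offline solution for `Γ`: the cache is initially empty, and the `i`-th request of the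
list changes it from `C i` to `C (i + 1)`. -/
def IsSchedule (k : ℕ) (Γ : List U) (C : ℕ → Finset U) : Prop :=
  C 0 = ∅ ∧ ∀ i : Fin Γ.length, Serves k (C i) (Γ.get i) (C (i + 1))

/-- The number of cache misses of a solution. -/
def scheduleCost (Γ : List U) (C : ℕ → Finset U) : ℕ :=
  (Finset.univ.filter fun i : Fin Γ.length => Γ.get i ∉ C i).card

/-- The least number of cache misses of an offline solution. -/
noncomputable def opt (k : ℕ) (Γ : List U) : ℕ :=
  sInf {m | ∃ C : ℕ → Finset U, IsSchedule k Γ C ∧ scheduleCost Γ C = m}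

/-- The time of the first request to `p` after time `t`; if there is none, it is
`Γ.length + 1` (for `t ≤ Γ.length`), because `List.idxOf` returns the length of the list when the
element does not occur. -/
def nextRequest (Γ : List U) (p : U) (t : ℕ) : ℕ :=
  t + 1 + (Γ.drop t).idxOf p

end Offline

/-! ### Randomized online algorithms with oracle queries -/

/-- A randomized online caching algorithm that may query an oracle.  When a page `p` is requested,
the algorithm first draws the set of pages to query, `queries s p`; it then receives the oracle's
answers on that set, and on no other page, and draws its next state.  It sees neither the requests
to come nor any other value of the oracle. -/
structure OnlineAlgorithm (U : Type u) where
  State : Type u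
  init : State
  cache : State → Finset U
  queries : State → U → PMF (Finset U)
  step : State → U → (S : Finset U) → (S → ℕ) → PMF State

/-- What happens at one request. -/
structure Event (U : Type u) where
  time : ℕ
  page : U
  before : Finset U
  queried : Finset U
  after : Finset U

/-- The expectation of a nonnegative quantity. -/
noncomputable def expect {α : Type u} (P : PMF α) (f : α → ℝ≥0∞) : ℝ≥0∞ :=
  ∑' a, P a * f a

section Online

variable {U : Type u}

/-- The random list of events when the algorithm serves the given requests, the first of them at
time `t`, starting from state `s`; the oracle's answer to the query for `q` at time `t` is
`τ q t`. -/
noncomputable def OnlineAlgorithm.runFrom (A : OnlineAlgorithm U) (τ : U → ℕ → ℕ) :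
    ℕ → A.State → List U → PMF (List (Event U))
  | _, _, [] => PMF.pure []
  | t, s, p :: Γ =>
    (A.queries s p).bind fun S =>
      (A.step s p S fun q => τ q t).bind fun s' =>
        (A.runFrom τ (t + 1) s' Γ).map fun H => ⟨t, p, A.cache s, S, A.cache s'⟩ :: H

/-- The random list of events when the algorithm serves `Γ`. -/
noncomputable def OnlineAlgorithm.run (A : OnlineAlgorithm U) (τ : U → ℕ → ℕ) (Γ : List U) :
    PMF (List (Event U)) :=
  A.runFrom τ 1 A.init Γ

variable [DecidableEq U]

/-- The number of cache misses. -/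
def misses (H : List (Event U)) : ℕ :=
  (H.map fun e => if e.page ∈ e.before then 0 else 1).sum

/-- The `ℓ₁` prediction error over the queries made. -/
def queryError (Γ : List U) (τ : U → ℕ → ℕ) (H : List (Event U)) : ℕ :=
  (H.map fun e => ∑ q ∈ e.queried,
    ((τ q e.time : ℤ) - (nextRequest Γ q e.time : ℤ)).natAbs).sum

/-- The algorithm starts with an empty cache, always serves the request within capacity `k`, and
only queries pages that are in its cache. -/
def OnlineAlgorithm.IsFeasible (A : OnlineAlgorithm U) (k : ℕ) : Prop :=
  A.cache A.init = ∅ ∧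
    ∀ (τ : U → ℕ → ℕ) (Γ : List U), ∀ H ∈ (A.run τ Γ).support, ∀ e ∈ H,
      Serves k e.before e.page e.after ∧ e.queried ⊆ e.before

/-- In every possible run, the algorithm makes at most `b` queries at each cache miss, and no
queries at other requests. -/
def OnlineAlgorithm.QueriesAtMost (A : OnlineAlgorithm U) (b : ℕ) : Prop :=
  ∀ (τ : U → ℕ → ℕ) (Γ : List U), ∀ H ∈ (A.run τ Γ).support, ∀ e ∈ H,
    e.queried.card ≤ if e.page ∈ e.before then 0 else b

/-- The expected number of cache misses on `Γ` with a random oracle of law `μ` that is independent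
of the random choices of the algorithm. -/
noncomputable def OnlineAlgorithm.expectedCost (A : OnlineAlgorithm U)
    (μ : MeasureTheory.Measure (U → ℕ → ℕ)) (Γ : List U) : ℝ≥0∞ :=
  ∫⁻ τ, expect (A.run τ Γ) (fun H => (misses H : ℝ≥0∞)) ∂μ

/-- The expected `ℓ₁` prediction error over the queries that the algorithm makes on `Γ`. -/
noncomputable def OnlineAlgorithm.expectedError (A : OnlineAlgorithm U)
    (μ : MeasureTheory.Measure (U → ℕ → ℕ)) (Γ : List U) : ℝ≥0∞ :=
  ∫⁻ τ, expect (A.run τ Γ) (fun H => (queryError Γ τ H : ℝ≥0∞)) ∂μ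

end Online

/-! ### The adaptive query algorithm with a switch to random marking -/

/-- The state of the algorithm: the cache, the marked pages, and the position of each page in its
eviction chain of the current phase.  The position is `0` for a page that has not been evicted in
the current phase; a page evicted in order to serve `p` comes one position after `p`. -/
structure MarkState (U : Type u) where
  cache : Finset U
  marked : Finset U
  position : U → ℕ

section Adaptive

variable {U : Type u} [DecidableEq U]

/-- A new phase begins when a page is missing and the cache is full of marked pages: then all pages
are unmarked and the eviction chains are discarded. -/
def refresh (k : ℕ) (s : MarkState U) (p : U) : MarkState U :=
  if p ∉ s.cache ∧ k ≤ s.cache.card ∧ s.cache ⊆ s.marked then ⟨s.cache, ∅, fun _ => 0⟩ else s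

/-- The unmarked pages in the cache. -/
def MarkState.unmarked (s : MarkState U) : Finset U :=
  s.cache \ s.marked

/-- A uniformly random set of `b` elements of `W` (all of `W` if it has fewer). -/
noncomputable def sampleSubset (b : ℕ) (W : Finset U) : PMF (Finset U) :=
  PMF.uniformOfFinset (W.powersetCard (min b W.card))
    (Finset.powersetCard_nonempty.2 (min_le_right _ _))

/-- A uniformly random element of `W`; the value `none` occurs only if `W` is empty. -/
noncomputable def sampleElement (W : Finset U) : PMF (Option U) :=
  if h : W.Nonempty then (PMF.uniformOfFinset W h).map some else PMF.pure none

/-- The queried pages whose predicted next request is the furthest. -/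
def furthest (S : Finset U) (ans : S → ℕ) : Finset U :=
  (Finset.univ.filter fun q : S => ∀ r : S, ans r ≤ ans q).image Subtype.val

/-- Remove the page `v` (if any), whose position in its eviction chain is one more than that of
`p`, then fetch and mark `p`. -/
def MarkState.replace (s : MarkState U) (p : U) : Option U → MarkState U
  | none => ⟨insert p s.cache, insert p s.marked, s.position⟩
  | some v => ⟨insert p (s.cache.erase v), insert p s.marked,
      Function.update s.position v (s.position p + 1)⟩

/-- The set of pages queried when `p` is requested: a uniformly random set of `b` unmarked pages if
a page has to be evicted and the position of `p` in its eviction chain is at most `log k`, and no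
pages otherwise. -/
noncomputable def adaptiveQueries (k b : ℕ) (s : MarkState U) (p : U) : PMF (Finset U) :=
  let s₁ := refresh k s p
  if p ∉ s.cache ∧ k ≤ s.cache.card ∧ (s₁.position p : ℝ) ≤ Real.logb 2 k then
    sampleSubset b s₁.unmarked
  else PMF.pure ∅

/-- The transition when `p` is requested.  At a hit, `p` is marked.  At a miss with room in the
cache, `p` is fetched and marked.  At a miss with a full cache, the victim is the queried page with
the furthest predicted next request (ties are broken at random) as long as the position of `p` in
its eviction chain is at most `log k`, and a uniformly random unmarked page afterwards. -/
noncomputable def adaptiveStep (k : ℕ) (s : MarkState U) (p : U) (S : Finset U) (ans : S → ℕ) :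
    PMF (MarkState U) :=
  let s₁ := refresh k s p
  if p ∈ s.cache then PMF.pure ⟨s.cache, insert p s.marked, s.position⟩
  else if s.cache.card < k then PMF.pure (s.replace p none)
  else if (s₁.position p : ℝ) ≤ Real.logb 2 k then
    (sampleElement (furthest S ans)).map (s₁.replace p)
  else (sampleElement s₁.unmarked).map (s₁.replace p)

/-- The algorithm AdaptiveQuery-`b` for cache size `k`, with the switch to uniformly random marking
once an eviction chain becomes longer than `log k`. -/
noncomputable def adaptiveQuery (U : Type u) [DecidableEq U] (k b : ℕ) : OnlineAlgorithm U where
  State := MarkState U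
  init := ⟨∅, ∅, fun _ => 0⟩
  cache := MarkState.cache
  queries := adaptiveQueries k b
  step := adaptiveStep k

end Adaptive

end Caching

namespace Caching

/-! ### Expectations over finite random choices and runs -/

section Expectation

variable {α β : Type u}

/-! The cost is charged to clean requests, that is, first requests in a phase to pages not requested
in the phase before. The phases depend only on `Γ`, and there are at most `2 * opt` clean requests
(`cleanCount_le_two_mul_opt`): an offline solution must fetch the excess of the pages of two
consecutive phases over `k`, and each of its misses is counted for at most two pairs of phases.

Every other miss continues an eviction chain. Such a chain is controlled by the rank of its last
evicted page `v`: the number of unmarked cached pages first requested after `v`. When `v` comes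
back, the next victim is drawn from the unmarked pages, and only those still to be requested matter,
say `r` of them. If the best of `b` samples is evicted, the new rank plus one averages at most `(r +
1) / (b + 1)`, so by concavity its logarithm to base `b + 1` falls by one on average
(`sum_one_add_gain_le`). Hence about `log_{b+1} k` misses per chain. A wrong prediction raises the
rank by at most the error on the sample, and `gain` grows at most linearly, so errors enter
additively (`one_add_gain_rank_le`). A uniformly random eviction is the case `b = 1` without error.

Both bounds come from one potential argument. A function `ψ j r` of chain position and rank is
summed over the missing pages of the previous phase, and `step_bound` shows that a miss is paid for
by the drop of this sum, by `K` at a clean request, and by `C` times the error. `learnedPotential`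
follows the logarithmic decay and saves `2` per queried eviction, so that after `log₂ k` of them the
savings pay for the random part of the chain. `robustPotential` ignores the predictions: at most
about `log₂ k` queried evictions are followed by an expected `O(log k)` random ones. All of this
holds for each fixed oracle; integrating over its law gives the theorem. -/

theorem expect_pure (a : α) (f : α → ℝ≥0∞) : expect (PMF.pure a) f = f a := by
  unfold expect
  rw [tsum_eq_single a]
  · simp
  · intro b hb
    simp [PMF.pure_apply, hb]

theorem expect_bind (P : PMF α) (Q : α → PMF β) (f : β → ℝ≥0∞) :
    expect (P.bind Q) f = expect P fun a => expect (Q a) f := by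
  unfold expect
  simp only [PMF.bind_apply, ← ENNReal.tsum_mul_right, ← ENNReal.tsum_mul_left]
  rw [ENNReal.tsum_comm]
  simp only [mul_assoc]

theorem expect_map (P : PMF α) (g : α → β) (f : β → ℝ≥0∞) :
    expect (P.map g) f = expect P fun a => f (g a) := by
  rw [← PMF.bind_pure_comp, expect_bind]
  simp only [Function.comp_apply, expect_pure]

theorem expect_add (P : PMF α) (f g : α → ℝ≥0∞) :
    (expect P fun a => f a + g a) = expect P f + expect P g := by
  simp only [expect, mul_add, ENNReal.tsum_add]

theorem expect_const (P : PMF α) (c : ℝ≥0∞) : (expect P fun _ => c) = c := by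
  simp only [expect, ENNReal.tsum_mul_right, P.tsum_coe, one_mul]

theorem expect_mul_left (P : PMF α) (c : ℝ≥0∞) (f : α → ℝ≥0∞) :
    (expect P fun a => c * f a) = c * expect P f := by
  simp only [expect, ← ENNReal.tsum_mul_left, mul_left_comm]

theorem expect_mono {P : PMF α} {f g : α → ℝ≥0∞} (h : ∀ a ∈ P.support, f a ≤ g a) :
    expect P f ≤ expect P g := by
  refine ENNReal.tsum_le_tsum fun a => ?_
  by_cases ha : P a = 0
  · simp [ha]
  · gcongr
    exact h a ((P.mem_support_iff a).2 ha)

theorem expect_le_of_forall {P : PMF α} {f : α → ℝ≥0∞} {c : ℝ≥0∞}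
    (h : ∀ a ∈ P.support, f a ≤ c) : expect P f ≤ c :=
  (expect_mono h).trans_eq (expect_const P c)

theorem expect_uniformOfFinset (T : Finset α) (hT : T.Nonempty) (f : α → ℝ≥0∞) :
    expect (PMF.uniformOfFinset T hT) f = (T.card : ℝ≥0∞)⁻¹ * ∑ a ∈ T, f a := by
  classical
  unfold expect
  rw [tsum_eq_sum (s := T), Finset.mul_sum]
  · refine Finset.sum_congr rfl fun a ha => ?_
    rw [PMF.uniformOfFinset_apply_of_mem hT ha]
  · intro a ha
    rw [PMF.uniformOfFinset_apply_of_notMem hT ha, zero_mul]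

theorem mem_support_sampleSubset {b : ℕ} {W S : Finset α} :
    S ∈ (sampleSubset b W).support ↔ S ⊆ W ∧ S.card = min b W.card := by
  simp only [sampleSubset, PMF.mem_support_uniformOfFinset_iff, Finset.mem_powersetCard]

theorem expect_sampleSubset (b : ℕ) (W : Finset α) (f : Finset α → ℝ≥0∞) :
    expect (sampleSubset b W) f =
      (W.card.choose (min b W.card) : ℝ≥0∞)⁻¹ * ∑ S ∈ W.powersetCard (min b W.card), f S := by
  rw [sampleSubset, expect_uniformOfFinset, Finset.card_powersetCard]

theorem expect_sampleElement {W : Finset α} (hW : W.Nonempty) (f : Option α → ℝ≥0∞) :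
    expect (sampleElement W) f = (W.card : ℝ≥0∞)⁻¹ * ∑ v ∈ W, f (some v) := by
  rw [sampleElement, dif_pos hW, expect_map, expect_uniformOfFinset]

theorem exists_of_mem_support_sampleElement {W : Finset α} (hW : W.Nonempty) {o : Option α}
    (ho : o ∈ (sampleElement W).support) : ∃ v ∈ W, o = some v := by
  rw [sampleElement, dif_pos hW, PMF.mem_support_map_iff] at ho
  obtain ⟨v, hv, rfl⟩ := ho
  exact ⟨v, by simpa using hv, rfl⟩

theorem expect_runFrom_cons (A : OnlineAlgorithm α) (τ : α → ℕ → ℕ) (t : ℕ) (s : A.State) (p : α)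
    (Γ : List α) (f : List (Event α) → ℝ≥0∞) :
    expect (A.runFrom τ t s (p :: Γ)) f =
      expect (A.queries s p) fun S => expect (A.step s p S fun q => τ q t) fun s' =>
        expect (A.runFrom τ (t + 1) s' Γ) fun H => f (⟨t, p, A.cache s, S, A.cache s'⟩ :: H) := by
  simp only [OnlineAlgorithm.runFrom, expect_bind, expect_map]

/-- Events do not record the state, so properties of runs are derived from an invariant of the
states. -/
theorem forall_event_of_invariant (A : OnlineAlgorithm α) (τ : α → ℕ → ℕ) (I : A.State → Prop)
    (P : Event α → Prop)
    (h : ∀ t s p, I s → ∀ S ∈ (A.queries s p).support,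
      ∀ s' ∈ (A.step s p S fun q => τ q t).support,
        I s' ∧ P ⟨t, p, A.cache s, S, A.cache s'⟩) :
    ∀ (Γ : List α) (t : ℕ) (s : A.State), I s →
      ∀ H ∈ (A.runFrom τ t s Γ).support, ∀ e ∈ H, P e := by
  intro Γ
  induction Γ with
  | nil =>
    intro t s _ H hH e he
    simp only [OnlineAlgorithm.runFrom, PMF.support_pure, Set.mem_singleton_iff] at hH
    simp [hH] at he
  | cons p Γ ih =>
    intro t s hs H hH e he
    simp only [OnlineAlgorithm.runFrom, PMF.mem_support_bind_iff, PMF.mem_support_map_iff] at hH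
    obtain ⟨S, hS, s', hs', H', hH', rfl⟩ := hH
    obtain ⟨h1, h2⟩ := h t s p hs S hS s' hs'
    rcases List.mem_cons.1 he with rfl | he
    · exact h2
    · exact ih _ _ h1 H' hH' e he

end Expectation

/-! ### Feasibility and the number of queries -/

section Feasibility

variable {U : Type u} [DecidableEq U]

theorem furthest_nonempty {S : Finset U} (hS : S.Nonempty) (ans : S → ℕ) :
    (furthest S ans).Nonempty := by
  obtain ⟨x, hx⟩ := hS
  obtain ⟨q, -, hq⟩ := Finset.exists_max_image (Finset.univ : Finset S) ans ⟨⟨x, hx⟩, by simp⟩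
  exact ⟨q, by simpa [furthest] using fun a ha => hq ⟨a, ha⟩ (by simp)⟩

theorem mem_furthest_iff {S : Finset U} {ans : U → ℕ} {v : U} :
    v ∈ furthest S (fun q => ans q) ↔ v ∈ S ∧ ∀ r ∈ S, ans r ≤ ans v := by
  simp only [furthest, Finset.mem_image, Finset.mem_filter, Finset.mem_univ, true_and]
  constructor
  · rintro ⟨q, hq, rfl⟩
    exact ⟨q.2, fun r hr => hq ⟨r, hr⟩⟩
  · rintro ⟨hv, h⟩
    exact ⟨⟨v, hv⟩, fun r => h r r.2, rfl⟩

theorem furthest_subset (S : Finset U) (ans : S → ℕ) : furthest S ans ⊆ S := by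
  intro v hv
  simp only [furthest, Finset.mem_image] at hv
  obtain ⟨q, -, rfl⟩ := hv
  exact q.2

@[simp] theorem refresh_cache (k : ℕ) (s : MarkState U) (p : U) :
    (refresh k s p).cache = s.cache := by
  unfold refresh
  split_ifs <;> rfl

theorem unmarked_refresh_nonempty {k : ℕ} (hk : 0 < k) {s : MarkState U} {p : U}
    (hp : p ∉ s.cache) (hc : k ≤ s.cache.card) : (refresh k s p).unmarked.Nonempty := by
  unfold refresh MarkState.unmarked
  split_ifs with h
  · simpa using Finset.card_pos.1 (hk.trans_le hc)
  · exact Finset.sdiff_nonempty.2 fun hs => h ⟨hp, hc, hs⟩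

omit [DecidableEq U] in
theorem sample_nonempty {b : ℕ} (hb : 0 < b) {W S : Finset U} (hW : W.Nonempty)
    (hS : S ∈ (sampleSubset b W).support) : S.Nonempty := by
  rw [mem_support_sampleSubset] at hS
  rw [← Finset.card_pos, hS.2]
  exact lt_min hb hW.card_pos

theorem serves_replace_some {k : ℕ} {s : MarkState U} {p v : U} (hp : p ∉ s.cache)
    (hv : v ∈ s.cache) (hc : s.cache.card ≤ k) :
    Serves k s.cache p (s.replace p (some v)).cache := by
  refine ⟨Finset.mem_insert_self _ _, Finset.insert_subset_insert _ (Finset.erase_subset _ _), ?_⟩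
  change (insert p (s.cache.erase v)).card ≤ k
  rw [Finset.card_insert_of_notMem (fun h => hp (Finset.mem_of_mem_erase h)),
    Finset.card_erase_add_one hv]
  exact hc

theorem adaptiveStep_serves {k b : ℕ} (hk : 0 < k) (hb : 0 < b) {s : MarkState U}
    (hs : s.cache.card ≤ k) {p : U} {S : Finset U} (hS : S ∈ (adaptiveQueries k b s p).support)
    {ans : S → ℕ} {s' : MarkState U} (hs' : s' ∈ (adaptiveStep k s p S ans).support) :
    Serves k s.cache p s'.cache := by
  unfold adaptiveStep at hs'
  dsimp only at hs'
  split_ifs at hs' with h1 h2 h3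
  · simp only [PMF.support_pure, Set.mem_singleton_iff] at hs'
    subst hs'
    exact ⟨h1, Finset.subset_insert _ _, hs⟩
  · simp only [PMF.support_pure, Set.mem_singleton_iff] at hs'
    subst hs'
    exact ⟨Finset.mem_insert_self _ _, subset_rfl, (Finset.card_insert_le _ _).trans h2⟩
  · rw [PMF.mem_support_map_iff] at hs'
    obtain ⟨o, ho, rfl⟩ := hs'
    have hW := unmarked_refresh_nonempty hk h1 (not_lt.1 h2)
    unfold adaptiveQueries at hS
    dsimp only at hS
    rw [if_pos ⟨h1, not_lt.1 h2, h3⟩] at hS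
    obtain ⟨v, hv, rfl⟩ := exists_of_mem_support_sampleElement
      (furthest_nonempty (sample_nonempty hb hW hS) ans) ho
    have hvc : v ∈ (refresh k s p).cache :=
      Finset.sdiff_subset ((mem_support_sampleSubset.1 hS).1 (furthest_subset _ _ hv))
    simpa using serves_replace_some (s := refresh k s p) (by simpa using h1) hvc (by simpa using hs)
  · rw [PMF.mem_support_map_iff] at hs'
    obtain ⟨o, ho, rfl⟩ := hs'
    have hW := unmarked_refresh_nonempty hk h1 (not_lt.1 h2)
    obtain ⟨v, hv, rfl⟩ := exists_of_mem_support_sampleElement hW ho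
    simpa using serves_replace_some (s := refresh k s p) (by simpa using h1)
      (Finset.sdiff_subset hv) (by simpa using hs)

theorem adaptiveQueries_subset {k b : ℕ} {s : MarkState U} {p : U} {S : Finset U}
    (hS : S ∈ (adaptiveQueries k b s p).support) :
    S ⊆ s.cache ∧ S.card ≤ if p ∈ s.cache then 0 else b := by
  unfold adaptiveQueries at hS
  dsimp only at hS
  split_ifs at hS with h
  · rw [mem_support_sampleSubset] at hS
    rw [if_neg h.1, hS.2]
    refine ⟨hS.1.trans ?_, min_le_left _ _⟩
    exact Finset.sdiff_subset.trans (refresh_cache k s p).subset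
  · simp only [PMF.support_pure, Set.mem_singleton_iff] at hS
    simp [hS]

theorem adaptiveQuery_isFeasible {k b : ℕ} (hk : 0 < k) (hb : 0 < b) :
    (adaptiveQuery U k b).IsFeasible k := by
  refine ⟨rfl, fun τ Γ => ?_⟩
  refine forall_event_of_invariant (adaptiveQuery U k b) τ
    (fun s : MarkState U => s.cache.card ≤ k) _ ?_ Γ 1 _ (by simp [adaptiveQuery])
  intro t s p hs S hS s' hs'
  have h := adaptiveStep_serves hk hb hs hS hs'
  exact ⟨h.2.2, h, (adaptiveQueries_subset hS).1⟩

theorem adaptiveQuery_queriesAtMost (k b : ℕ) : (adaptiveQuery U k b).QueriesAtMost b := by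
  intro τ Γ
  refine forall_event_of_invariant (adaptiveQuery U k b) τ (fun _ => True) _ ?_ Γ 1 _ trivial
  intro t s p _ S hS s' _
  exact ⟨trivial, (adaptiveQueries_subset hS).2⟩

end Feasibility

/-! ### Clean requests against the offline optimum -/

section OfflineBound

variable {U : Type u} [DecidableEq U]

/-- The number of clean requests of a marking algorithm on `Γ`, that is, of first requests in a
phase to pages that were not requested in the phase before, if `prev` is the set of pages requested
in the previous phase and `marked` the set of pages requested so far in the current one. -/
def cleanCount (k : ℕ) : Finset U → Finset U → List U → ℕ
  | _, _, [] => 0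
  | prev, marked, p :: Γ =>
    if p ∈ marked then cleanCount k prev marked Γ
    else if k ≤ marked.card then 1 + cleanCount k marked {p} Γ
    else (if p ∈ prev then 0 else 1) + cleanCount k prev (insert p marked) Γ

theorem scheduleCost_cons (p : U) (Γ : List U) (C : ℕ → Finset U) :
    scheduleCost (p :: Γ) C = (if p ∈ C 0 then 0 else 1) + scheduleCost Γ fun i => C (i + 1) := by
  unfold scheduleCost
  refine (Fin.card_filter_univ_succ fun i : Fin (Γ.length + 1) => (p :: Γ).get i ∉ C i).trans ?_
  by_cases h : p ∈ C 0
  · simp [h]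
  · simp [h, add_comm]

/-- The only page that can be new among those requested or held is `p`, and it is new only at an
offline miss. -/
theorem card_sdiff_serves {C A R C' : Finset U} {p : U} {k : ℕ} (h : Serves k C p C') :
    ((insert p R ∪ C') \ A).card ≤ ((R ∪ C) \ A).card + if p ∈ C then 0 else 1 := by
  split_ifs with hp
  · refine Finset.card_le_card (Finset.sdiff_subset_sdiff ?_ subset_rfl)
    intro x hx
    have := @h.2.1 x
    grind
  · refine (Finset.card_le_card (t := insert p ((R ∪ C) \ A)) ?_).trans (Finset.card_insert_le _ _)
    intro x hx
    have := @h.2.1 x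
    grind

/-- Think of `A₀` and `A₁` as the offline caches at the start of the previous and of the current
phase, and of `X` and `Y` as the offline misses in these phases so far. The difference of the
cardinalities of `prev ∪ marked` and `prev` counts the clean requests so far in the current phase.
Pages of both phases outside `A₀` were fetched offline, so it is at most `X + Y`. A miss counts once
for its own phase and once for the next, which explains `X + 2 * Y` and the factor `2`. -/
theorem cleanCount_le_aux (k : ℕ) :
    ∀ (Γ : List U) (C : ℕ → Finset U) (prev marked A₀ A₁ : Finset U) (X Y : ℕ),
      (∀ i : Fin Γ.length, Serves k (C i) (Γ.get i) (C (i + 1))) →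
      (C 0).card ≤ k → A₁.card ≤ k → marked.card ≤ k → A₀.card ≤ prev.card →
      ((prev ∪ marked ∪ C 0) \ A₀).card ≤ X + Y → ((marked ∪ C 0) \ A₁).card ≤ Y →
      cleanCount k prev marked Γ + (prev ∪ marked).card ≤
        X + 2 * Y + 2 * scheduleCost Γ C + prev.card := by
  intro Γ
  induction Γ with
  | nil =>
    intro C prev marked A₀ A₁ X Y _ _ _ _ hA hXY _
    have h1 : (prev ∪ marked).card ≤ ((prev ∪ marked ∪ C 0) \ A₀).card + A₀.card := by
      refine (Finset.card_le_card ?_).trans (Finset.card_union_le _ _)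
      intro x; grind
    simp only [cleanCount]
    omega
  | cons p Γ ih =>
    intro C prev marked A₀ A₁ X Y hC hC0 hA1 hm hA hXY hY
    have hp : Serves k (C 0) p (C 1) := hC ⟨0, by simp⟩
    have htail : ∀ i : Fin Γ.length, Serves k (C (i + 1)) (Γ.get i) (C (i + 1 + 1)) := by
      intro i
      exact hC i.succ
    have key := fun prev marked A₀ A₁ X Y => ih (fun i => C (i + 1)) prev marked A₀ A₁ X Y htail
      hp.2.2
    have s0 := fun R A => card_sdiff_serves (A := A) (R := R) hp
    rw [scheduleCost_cons]
    set e := if p ∈ C 0 then 0 else 1 with he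
    simp only [cleanCount]
    split_ifs with h1 h2 h3
    · have := key prev marked A₀ A₁ X (Y + e) hA1 hm hA
        (by have := s0 (prev ∪ marked) A₀
            rw [Finset.insert_eq_of_mem (Finset.mem_union_right _ h1)] at this
            simp only [zero_add]; omega)
        (by have := s0 marked A₁
            rw [Finset.insert_eq_of_mem h1] at this
            simp only [zero_add]; omega)
      omega
    · have hk : ({p} : Finset U).card ≤ k :=
        (Finset.card_le_card (Finset.singleton_subset_iff.2 hp.1)).trans hp.2.2
      -- A new phase: the data of the current phase move to the previous one, and the offline cache
      -- of this moment becomes the new reference set. The finished phase was full, which gives the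
      -- bound on `A₁` required of the first reference set.
      have h4 := key marked {p} A₁ (C 0) Y e hC0 hk (hA1.trans h2)
        (by have := s0 marked A₁
            rw [Finset.union_singleton]
            simp only [zero_add]; omega)
        (by have := s0 ∅ (C 0)
            simpa using this)
      rw [Finset.union_singleton, Finset.card_insert_of_notMem h1] at h4
      -- This settles the clean requests of the finished phase.
      have h5 : (prev ∪ marked).card ≤ ((prev ∪ marked ∪ C 0) \ A₀).card + A₀.card := by
        refine (Finset.card_le_card ?_).trans (Finset.card_union_le _ _)
        intro x; grind
      omega
    all_goals
      have h4 := key prev (insert p marked) A₀ A₁ X (Y + e) hA1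
        (by rw [Finset.card_insert_of_notMem h1]; omega) hA
        (by have := s0 (prev ∪ marked) A₀
            rw [Finset.union_insert]
            simp only [zero_add]; omega)
        (by have := s0 marked A₁
            simp only [zero_add]; omega)
      rw [Finset.union_insert] at h4
    · rw [Finset.insert_eq_of_mem (Finset.mem_union_left _ h3)] at h4
      omega
    · rw [Finset.card_insert_of_notMem (by simp [h1, h3])] at h4
      omega

/-- Holding only the last requested page works. Without a solution the infimum in `opt` would take
the junk value `0`. -/
theorem exists_isSchedule {k : ℕ} (hk : 0 < k) (Γ : List U) : ∃ C, IsSchedule k Γ C := by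
  refine ⟨fun i => match i with
    | 0 => ∅
    | i + 1 => if h : i < Γ.length then {Γ[i]} else ∅, rfl, fun i => ?_⟩
  simp [Serves, hk, Nat.succ_le_iff]

theorem cleanCount_le_two_mul_opt {k : ℕ} (hk : 0 < k) (Γ : List U) :
    cleanCount k ∅ ∅ Γ ≤ 2 * opt k Γ := by
  have hne : {m | ∃ C : ℕ → Finset U, IsSchedule k Γ C ∧ scheduleCost Γ C = m}.Nonempty :=
    let ⟨C, hC⟩ := exists_isSchedule hk Γ
    ⟨_, C, hC, rfl⟩
  obtain ⟨C, hC, hcost⟩ := Nat.sInf_mem hne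
  have := cleanCount_le_aux k Γ C ∅ ∅ ∅ ∅ 0 0 hC.2 (by simp [hC.1]) (by simp) (by simp) (by simp)
    (by simp [hC.1]) (by simp [hC.1])
  rw [opt, ← hcost]
  simpa using this

theorem cleanCount_cons_pos (k : ℕ) (p : U) (Γ : List U) : 0 < cleanCount k ∅ ∅ (p :: Γ) := by
  simp only [cleanCount]
  simp only [Finset.notMem_empty, if_false]
  split_ifs <;> omega

end OfflineBound

/-! ### Expected progress of the best of `b` samples -/

section Averaging

/-- A bound for the expected number of further misses in an eviction chain when `r` unmarked pages
remain and the best of `b` samples is evicted each time. -/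
noncomputable def gain (b r : ℕ) : ℝ :=
  if r = 0 then 0 else 1 + Real.logb (b + 1) (1 + r)

theorem logb_one_add_nonneg (b r : ℕ) : 0 ≤ Real.logb (b + 1) (1 + r) :=
  div_nonneg (Real.log_nonneg (by simp)) (Real.log_nonneg (by simp))

theorem gain_nonneg (b r : ℕ) : 0 ≤ gain b r := by
  unfold gain
  have := logb_one_add_nonneg b r
  split_ifs <;> linarith

theorem gain_le (b r : ℕ) : gain b r ≤ 1 + Real.logb (b + 1) (1 + r) := by
  unfold gain
  have := logb_one_add_nonneg b r
  split_ifs <;> linarith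

theorem one_lt_cast_add_one {b : ℕ} (hb : 0 < b) : (1 : ℝ) < b + 1 := by
  have : (0 : ℝ) < b := by exact_mod_cast hb
  linarith

theorem gain_mono {b : ℕ} (hb : 0 < b) : Monotone (gain b) := by
  intro r s h
  by_cases hr : r = 0
  · rw [gain, if_pos hr]
    exact gain_nonneg b s
  · rw [gain, gain, if_neg hr, if_neg (by omega)]
    have : (r : ℝ) ≤ s := by exact_mod_cast h
    gcongr
    exact one_lt_cast_add_one hb

theorem logb_one_add_le {b : ℕ} (hb : 0 < b) (n : ℕ) : Real.logb (b + 1) (1 + n) ≤ n := by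
  have h1 := one_lt_cast_add_one hb
  rw [Real.logb_le_iff_le_rpow h1 (by positivity), Real.rpow_natCast]
  have h := one_add_mul_le_pow (a := (b : ℝ)) (by linarith) n
  have h2 : (1 : ℝ) ≤ b := by exact_mod_cast hb
  have h3 : (n : ℝ) * 1 ≤ n * b := by gcongr
  rw [add_comm (b : ℝ) 1]
  linarith

/-- The logarithm of `1 + n` is subadditive in `n` and at most `n` by Bernoulli. The factor `2`
absorbs the jump of `gain` at `0`. -/
theorem gain_add_le {b : ℕ} (hb : 0 < b) (x y : ℕ) : gain b (x + y) ≤ gain b x + 2 * y := by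
  have hy := logb_one_add_le hb y
  rcases Nat.eq_zero_or_pos y with rfl | hy0
  · simp
  have hy1 : (1 : ℝ) ≤ y := by exact_mod_cast hy0
  rcases Nat.eq_zero_or_pos x with rfl | hx0
  · have := gain_le b (0 + y)
    rw [zero_add] at this ⊢
    have := gain_nonneg b 0
    linarith
  · rw [gain, gain, if_neg (by omega), if_neg (by omega)]
    have h1 := one_lt_cast_add_one hb
    have : Real.logb (b + 1) (1 + (x + y : ℕ)) ≤
        Real.logb (b + 1) (1 + x) + Real.logb (b + 1) (1 + y) := by
      rw [← Real.logb_mul (by positivity) (by positivity)]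
      refine Real.logb_le_logb_of_le h1 (by positivity) ?_
      push_cast
      nlinarith [mul_nonneg (Nat.cast_nonneg (α := ℝ) x) (Nat.cast_nonneg (α := ℝ) y)]
    linarith

theorem gain_le_two_mul {b : ℕ} (hb : 0 < b) (y : ℕ) : gain b y ≤ 2 * y := by
  simpa [gain] using gain_add_le hb 0 y

variable {U : Type u} [DecidableEq U]

/-- A pair `(S, u)` can be recovered from `insert u S`, in which `u` is the unique maximum of `a`.
Only an inequality holds because `a` may have ties. -/
theorem sum_card_above_le (F : Finset U) (a : U → ℕ) (b : ℕ) :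
    ∑ S ∈ F.powersetCard b, (F.filter fun u => ∀ x ∈ S, a x < a u).card ≤
      F.card.choose (b + 1) := by
  rw [← Finset.card_sigma, ← Finset.card_powersetCard]
  refine Finset.card_le_card_of_injOn (fun z => insert z.2 z.1) ?_ ?_
  · rintro ⟨S, u⟩ h
    simp only [Finset.coe_sigma, Set.mem_sigma_iff, Finset.mem_coe, Finset.mem_powersetCard,
      Finset.mem_filter] at h ⊢
    have hu : u ∉ S := fun hu => lt_irrefl _ (h.2.2 u hu)
    exact ⟨Finset.insert_subset h.2.1 h.1.1, by rw [Finset.card_insert_of_notMem hu, h.1.2]⟩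
  · rintro ⟨S, u⟩ h ⟨S', u'⟩ h' heq
    simp only [Finset.coe_sigma, Set.mem_sigma_iff, Finset.mem_coe, Finset.mem_filter] at h h' heq
    have hu : u ∉ S := fun hu => lt_irrefl _ (h.2.2 u hu)
    have hu' : u' ∉ S' := fun hu => lt_irrefl _ (h'.2.2 _ hu)
    have : u = u' := by
      by_contra hne
      have h1 : u ∈ insert u' S' := heq ▸ Finset.mem_insert_self _ _
      have h2 : u' ∈ insert u S := heq ▸ Finset.mem_insert_self _ _
      have h3 := h'.2.2 u (Finset.mem_of_mem_insert_of_ne h1 hne)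
      have h4 := h.2.2 u' (Finset.mem_of_mem_insert_of_ne h2 (Ne.symm hne))
      omega
    subst this
    have : S = S' := by
      rw [← Finset.erase_insert hu, heq, Finset.erase_insert hu']
    rw [this]

/-- Jensen's inequality for the logarithm, by its tangent at `x₀ = (r + 1) / (b + 1)`, an upper
bound for the mean of one plus the number of elements above the sample. Dividing by `b + 1` lowers
the logarithm by exactly one, which cancels the extra `1 +`. -/
theorem sum_one_add_gain_le {b : ℕ} (hb : 0 < b) (F : Finset U) (a : U → ℕ) (hF : b ≤ F.card) :
    ∑ S ∈ F.powersetCard b, (1 + gain b (F.filter fun u => ∀ x ∈ S, a x < a u).card) ≤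
      F.card.choose b * gain b F.card := by
  set r := F.card with hr
  set m : Finset U → ℕ := fun S => (F.filter fun u => ∀ x ∈ S, a x < a u).card with hm
  have hb1 := one_lt_cast_add_one hb
  have hlog : 0 < Real.log (b + 1) := Real.log_pos hb1
  set x₀ : ℝ := (r + 1) / (b + 1) with hx₀
  have hx₀pos : 0 < x₀ := by positivity
  have hpt : ∀ i : ℕ, Real.logb (b + 1) (1 + i) ≤
      Real.logb (b + 1) (1 + r) - 1 + ((1 + i) / x₀ - 1) / Real.log (b + 1) := by
    intro i
    have h1 : Real.log ((1 + i) / x₀) ≤ (1 + i) / x₀ - 1 :=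
      Real.log_le_sub_one_of_pos (by positivity)
    have h2 : Real.logb (b + 1) (1 + i) =
        Real.logb (b + 1) (1 + r) - 1 + Real.logb (b + 1) ((1 + i) / x₀) := by
      rw [Real.logb_div (by positivity) hx₀pos.ne', hx₀,
        Real.logb_div (by positivity) (by positivity), Real.logb_self_eq_one hb1,
        add_comm (r : ℝ) 1]
      ring
    rw [h2]
    gcongr
    rw [Real.logb]
    gcongr
  have hsum : ∑ S ∈ F.powersetCard b, ((1 + (m S : ℝ)) / x₀ - 1) ≤ 0 := by
    rw [Finset.sum_sub_distrib, ← Finset.sum_div, Finset.sum_add_distrib]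
    simp only [Finset.sum_const, Finset.card_powersetCard, nsmul_eq_mul, mul_one]
    rw [sub_nonpos, div_le_iff₀ hx₀pos]
    have h1 : (∑ S ∈ F.powersetCard b, (m S : ℝ)) ≤ r.choose (b + 1) := by
      exact_mod_cast sum_card_above_le F a b
    -- With Pascal's rule this identifies the number of samples times `x₀` with the bound on the sum
    -- of the terms `1 + m S`.
    have h2 : ((r + 1 : ℕ) : ℝ) * r.choose b = (r + 1).choose (b + 1) * (b + 1 : ℕ) := by
      exact_mod_cast Nat.add_one_mul_choose_eq r b
    have h3 : ((r + 1).choose (b + 1) : ℝ) = r.choose b + r.choose (b + 1) := by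
      exact_mod_cast Nat.choose_succ_succ r b
    have h4 : (r.choose b : ℝ) * x₀ = r.choose b + r.choose (b + 1) := by
      rw [← h3, hx₀, mul_div_assoc', div_eq_iff (by positivity)]
      push_cast at h2
      linarith
    linarith
  have hg : gain b r = 1 + Real.logb (b + 1) (1 + r) := if_neg (by omega)
  calc ∑ S ∈ F.powersetCard b, (1 + gain b (m S))
      ≤ ∑ S ∈ F.powersetCard b,
          (gain b r + ((1 + (m S : ℝ)) / x₀ - 1) * (Real.log (b + 1))⁻¹) := by
        refine Finset.sum_le_sum fun S _ => ?_
        have h1 := hpt (m S)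
        have h2 := gain_le b (m S)
        rw [div_eq_mul_inv _ (Real.log _)] at h1
        linarith
    _ = r.choose b * gain b r +
          (∑ S ∈ F.powersetCard b, ((1 + (m S : ℝ)) / x₀ - 1)) * (Real.log (b + 1))⁻¹ := by
        rw [Finset.sum_add_distrib, ← Finset.sum_mul]
        simp [hr]
    _ ≤ r.choose b * gain b r := by
        have := mul_nonpos_of_nonpos_of_nonneg hsum (inv_nonneg.2 hlog.le)
        linarith

theorem sum_sample_gain_le {b : ℕ} (hb : 0 < b) {W F : Finset U} (hW : W.Nonempty) (hFW : F ⊆ W)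
    (a : U → ℕ) :
    ∑ S ∈ W.powersetCard (min b W.card),
        (if S ⊆ F then 1 + gain b (F.filter fun u => ∀ x ∈ S, a x < a u).card else 0) ≤
      W.card.choose (min b W.card) * gain b F.card := by
  have hfil : (W.powersetCard (min b W.card)).filter (· ⊆ F) = F.powersetCard (min b W.card) := by
    ext S
    simp only [Finset.mem_filter, Finset.mem_powersetCard]
    exact ⟨fun h => ⟨h.2, h.1.2⟩, fun h => ⟨⟨h.1.trans hFW, h.2⟩, h.1⟩⟩
  rw [← Finset.sum_filter, hfil]
  have hg := gain_nonneg b F.card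
  rcases lt_or_ge F.card (min b W.card) with h | h
  · rw [Finset.powersetCard_eq_empty.2 h, Finset.sum_empty]
    positivity
  rcases le_total b W.card with hbW | hbW
  · rw [min_eq_left hbW] at h ⊢
    refine (sum_one_add_gain_le hb F a h).trans ?_
    gcongr
  · rw [min_eq_right hbW] at h ⊢
    have hFW' : F = W := Finset.eq_of_subset_of_card_le hFW h
    subst hFW'
    -- All of `W` is sampled, so nothing lies above the sample. The convention `gain b 0 = 0` is
    -- essential here: the left side must be `1`, as the logarithm on the right may be less than
    -- one.
    have hempty : (F.filter fun u => ∀ x ∈ F, a x < a u) = ∅ :=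
      Finset.filter_eq_empty_iff.2 fun u hu h => lt_irrefl _ (h u hu)
    rw [Finset.powersetCard_self, Finset.sum_singleton, hempty, Finset.card_empty,
      Nat.choose_self, gain, gain, if_pos rfl, if_neg hW.card_pos.ne']
    have := logb_one_add_nonneg b F.card
    push_cast
    linarith

end Averaging

/-! ### Effect of prediction errors on the rank -/

section Errors

variable {U : Type u} [DecidableEq U]

/-- The number of pages of `W` whose first request in `L` comes after that of `v`. -/
def rank (L : List U) (W : Finset U) (v : U) : ℕ :=
  (W.filter fun u => u ∈ L ∧ L.idxOf v < L.idxOf u).card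

/-- The error of the predictions `pr` on `S` when the requests after time `t` are `L`. -/
def predError (pr : U → ℕ) (t : ℕ) (L : List U) (S : Finset U) : ℕ :=
  ∑ q ∈ S, ((pr q : ℤ) - ((t + 1 + L.idxOf q : ℕ) : ℤ)).natAbs

/-- If the predictions order `x` and `v` wrongly, their two errors together cover the true gap. -/
theorem idxOf_sub_le_predError {pr : U → ℕ} {t : ℕ} {L : List U} {S : Finset U} {v x : U}
    (hv : v ∈ S) (hx : x ∈ S) (h : pr x ≤ pr v) :
    L.idxOf x - L.idxOf v ≤ predError pr t L S := by
  by_cases hxv : x = v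
  · simp [hxv]
  · have hsub : ({x, v} : Finset U) ⊆ S := by
      simp [Finset.insert_subset_iff, hv, hx]
    refine le_trans ?_ (Finset.sum_le_sum_of_subset hsub)
    rw [Finset.sum_pair hxv]
    omega

theorem card_between_le (L : List U) (W : Finset U) (m n : ℕ) :
    (W.filter fun u => u ∈ L ∧ m < L.idxOf u ∧ L.idxOf u ≤ n).card ≤ n - m := by
  rw [← Nat.card_Ioc]
  refine Finset.card_le_card_of_injOn L.idxOf ?_ ?_
  · intro u hu
    simp only [Finset.coe_filter, Set.mem_ofPred_eq] at hu
    simp [hu.2.2]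
  · intro u hu v _ h
    simp only [Finset.coe_filter, Set.mem_ofPred_eq] at hu
    exact (List.idxOf_inj hu.2.1).1 h

/-- Compare the victim `v` with the sampled page `x` whose next request is truly furthest: pages
requested between them number at most the gap, hence at most the error. If some sampled page is
never requested again, the error alone pays for the rank. -/
theorem one_add_gain_rank_le {b : ℕ} (hb : 0 < b) {pr : U → ℕ} {t : ℕ} {L : List U}
    {W S : Finset U} {v : U} (hS : S ⊆ W) (hvL : v ∈ L) (hv : v ∈ furthest S fun q => pr q) :
    1 + gain b (rank L W v) ≤
      (if S ⊆ W.filter (· ∈ L) then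
        1 + gain b ((W.filter (· ∈ L)).filter fun u => ∀ x ∈ S, L.idxOf x < L.idxOf u).card
        else 0) + 2 * (predError pr t L S : ℝ) := by
  rw [mem_furthest_iff] at hv
  split_ifs with h
  · obtain ⟨x, hxS, hx⟩ := Finset.exists_max_image S L.idxOf ⟨v, hv.1⟩
    have h1 : rank L W v ≤
        ((W.filter (· ∈ L)).filter fun u => ∀ x ∈ S, L.idxOf x < L.idxOf u).card +
          predError pr t L S := by
      refine le_trans ?_ (Nat.add_le_add_left ((card_between_le L W (L.idxOf v) (L.idxOf x)).trans
        (idxOf_sub_le_predError hv.1 hxS (hv.2 x hxS))) _)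
      refine (Finset.card_le_card ?_).trans (Finset.card_union_le _ _)
      intro u hu
      simp only [Finset.mem_filter, Finset.mem_union] at hu ⊢
      rcases lt_or_ge (L.idxOf x) (L.idxOf u) with hlt | hge
      · exact Or.inl ⟨⟨hu.1, hu.2.1⟩, fun y hy => (hx y hy).trans_lt hlt⟩
      · exact Or.inr ⟨hu.1, hu.2.1, hu.2.2, hge⟩
    have h2 := gain_mono hb h1
    have h3 := gain_add_le hb _ _ |>.trans' h2
    linarith
  · obtain ⟨x, hxS, hx⟩ := Finset.not_subset.1 h
    have hxL : x ∉ L := fun hxL => hx (by simp [hxL, hS hxS])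
    -- An absent page has index `L.length`, one beyond the last request, and this extra unit pays
    -- for the `1 +` in the claim.
    have h1 : rank L W v + 1 ≤ predError pr t L S := by
      refine le_trans ?_ (idxOf_sub_le_predError hv.1 hxS (hv.2 x hxS))
      rw [List.idxOf_of_notMem hxL]
      have h2 : rank L W v ≤ (L.length - 1) - L.idxOf v := by
        refine le_trans (Finset.card_le_card ?_) (card_between_le L W _ _)
        intro u hu
        simp only [Finset.mem_filter] at hu ⊢
        have := List.idxOf_lt_length_iff.2 hu.2.1
        exact ⟨hu.1, hu.2.1, hu.2.2, by omega⟩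
      have := List.idxOf_lt_length_iff.2 hvL
      omega
    have h2 := gain_le_two_mul hb (rank L W v)
    have h3 : (rank L W v : ℝ) + 1 ≤ predError pr t L S := by exact_mod_cast h1
    linarith

end Errors

/-! ### The potential argument -/

section Potential

variable {U : Type u} [DecidableEq U]

/-- The potential of an evicted page `v` at position `j` of its eviction chain, if `L` is the list
of requests to come and `W` the set of unmarked pages in the cache. -/
noncomputable def chainTerm (ψ : ℕ → ℕ → ℝ≥0∞) (j : ℕ) (L : List U) (W : Finset U) (v : U) :
    ℝ≥0∞ :=
  if v ∈ L then ψ j (rank L W v) else 0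

/-- The sum of the potentials of the pages of the previous phase that are not in the cache. -/
noncomputable def potential (ψ : ℕ → ℕ → ℝ≥0∞) (s : MarkState U) (prev : Finset U) (L : List U) :
    ℝ≥0∞ :=
  ∑ v ∈ prev \ s.cache, chainTerm ψ (s.position v) L s.unmarked v

/-- The function `ψ` pays for the misses of an eviction chain: `ψ j r` bounds the cost of serving a
page at position `j` when `r` unmarked pages in the cache are still to be requested, up to `C` times
the prediction error, and `K` pays for a clean request. -/
structure StepBounds (U : Type u) [DecidableEq U] (k b : ℕ) (ψ : ℕ → ℕ → ℝ≥0∞) (K C : ℝ≥0∞) :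
    Prop where
  mono : ∀ j, Monotone (ψ j)
  one_le : ∀ j r, 1 ≤ ψ j r
  clean : ∀ r ≤ k, ψ 0 r ≤ K
  query : ∀ (j : ℕ) (W : Finset U) (L : List U) (pr : U → ℕ) (t : ℕ), (j : ℝ) ≤ Real.logb 2 k →
    W.Nonempty → W.card ≤ k →
    1 + expect (sampleSubset b W) (fun S => expect (sampleElement (furthest S fun q => pr q))
      fun o => o.elim 0 (chainTerm ψ (j + 1) L W)) ≤
    ψ j (W.filter (· ∈ L)).card + C * expect (sampleSubset b W) fun S => (predError pr t L S : ℝ≥0∞)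
  random : ∀ (j : ℕ) (W : Finset U) (L : List U), ¬ (j : ℝ) ≤ Real.logb 2 k →
    W.Nonempty → W.card ≤ k →
    1 + expect (sampleElement W) (fun o => o.elim 0 (chainTerm ψ (j + 1) L W)) ≤
      ψ j (W.filter (· ∈ L)).card

/-- The relation between the state of the algorithm and the set of pages requested in the previous
phase. -/
structure PhaseInvariant (k : ℕ) (prev : Finset U) (s : MarkState U) : Prop where
  marked_subset : s.marked ⊆ s.cache
  cache_subset : s.cache ⊆ s.marked ∪ prev
  card_le : s.cache.card ≤ k
  mem_prev : ∀ x, s.position x ≠ 0 → x ∈ prev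

theorem rank_le_rank_cons {L : List U} {W W' : Finset U} {p v : U} (hW : W' ⊆ W) (hp : p ∉ W')
    (hv : v ≠ p) : rank L W' v ≤ rank (p :: L) W v := by
  refine Finset.card_le_card fun u hu => ?_
  simp only [Finset.mem_filter] at hu ⊢
  have hup : u ≠ p := fun h => hp (h ▸ hu.1)
  rw [List.idxOf_cons_ne _ hv.symm, List.idxOf_cons_ne _ hup.symm]
  exact ⟨hW hu.1, List.mem_cons_of_mem _ hu.2.1, by omega⟩

theorem chainTerm_le_cons {ψ : ℕ → ℕ → ℝ≥0∞} (hψ : ∀ j, Monotone (ψ j)) (j : ℕ) {L : List U}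
    {W W' : Finset U} {p v : U} (hW : W' ⊆ W) (hp : p ∉ W') (hv : v ≠ p) :
    chainTerm ψ j L W' v ≤ chainTerm ψ j (p :: L) W v := by
  unfold chainTerm
  simp only [List.mem_cons, hv, false_or]
  split_ifs
  · exact hψ j (rank_le_rank_cons hW hp hv)
  · exact le_rfl

theorem chainTerm_mono {ψ : ℕ → ℕ → ℝ≥0∞} (hψ : ∀ j, Monotone (ψ j)) (j : ℕ) (L : List U)
    {W W' : Finset U} (v : U) (hW : W' ⊆ W) : chainTerm ψ j L W' v ≤ chainTerm ψ j L W v := by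
  unfold chainTerm
  split_ifs
  · exact hψ j (Finset.card_le_card (Finset.filter_subset_filter _ hW))
  · exact le_rfl

/-- A page being requested now comes before every unmarked page still to be requested, so its rank
counts all of them. -/
theorem chainTerm_cons_self {ψ : ℕ → ℕ → ℝ≥0∞} (j : ℕ) (L : List U) {W : Finset U} {p : U}
    (hp : p ∉ W) : chainTerm ψ j (p :: L) W p = ψ j (W.filter (· ∈ L)).card := by
  unfold chainTerm rank
  rw [if_pos List.mem_cons_self]
  congr 2
  refine Finset.filter_congr fun u hu => ?_
  have hup : u ≠ p := fun h => hp (h ▸ hu)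
  rw [List.idxOf_cons_self, List.idxOf_cons_ne _ hup.symm]
  simp [hup]

/-- The term of `p` disappears and only that of `v` can be new; the other ranks cannot grow, since
the unmarked set shrinks. -/
theorem potential_replace_some_le {ψ : ℕ → ℕ → ℝ≥0∞} (hψ : ∀ j, Monotone (ψ j))
    {s : MarkState U} {prev : Finset U} {p v : U} (L : List U)
    (hv : v ∈ s.cache) :
    potential ψ (s.replace p (some v)) prev L ≤
      (∑ x ∈ (prev \ s.cache).erase p, chainTerm ψ (s.position x) (p :: L) s.unmarked x) +
        chainTerm ψ (s.position p + 1) L s.unmarked v := by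
  have hW : (s.replace p (some v)).unmarked ⊆ s.unmarked := by
    intro x
    simp only [MarkState.unmarked, MarkState.replace, Finset.mem_sdiff, Finset.mem_insert,
      Finset.mem_erase]
    tauto
  have hpW : p ∉ (s.replace p (some v)).unmarked := by
    simp [MarkState.unmarked, MarkState.replace]
  have hsub : prev \ (s.replace p (some v)).cache ⊆ insert v ((prev \ s.cache).erase p) := by
    intro x
    simp only [MarkState.replace, Finset.mem_sdiff, Finset.mem_insert, Finset.mem_erase]
    tauto
  refine (Finset.sum_le_sum_of_subset hsub).trans ?_
  rw [Finset.sum_insert (by simp [hv]), add_comm]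
  refine add_le_add (Finset.sum_le_sum fun x hx => ?_) ?_
  · simp only [Finset.mem_erase, Finset.mem_sdiff] at hx
    have hxv : x ≠ v := fun h => hx.2.2 (h ▸ hv)
    have : (s.replace p (some v)).position x = s.position x := by
      simp [MarkState.replace, hxv]
    rw [this]
    exact chainTerm_le_cons hψ _ hW hpW hx.1
  · have : (s.replace p (some v)).position v = s.position p + 1 := by
      simp [MarkState.replace]
    rw [this]
    exact chainTerm_mono hψ _ _ _ hW

theorem potential_mark_le {ψ : ℕ → ℕ → ℝ≥0∞} (hψ : ∀ j, Monotone (ψ j)) (s : MarkState U)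
    (prev : Finset U) (p : U) (L : List U) :
    potential ψ ⟨insert p s.cache, insert p s.marked, s.position⟩ prev L ≤
      ∑ x ∈ (prev \ s.cache).erase p, chainTerm ψ (s.position x) (p :: L) s.unmarked x := by
  have hset : prev \ insert p s.cache = (prev \ s.cache).erase p := by
    ext x
    simp only [Finset.mem_sdiff, Finset.mem_insert, Finset.mem_erase]
    tauto
  unfold potential
  rw [hset]
  refine Finset.sum_le_sum fun x hx => chainTerm_le_cons hψ _ ?_ ?_ (Finset.ne_of_mem_erase hx)
  · intro y
    simp only [MarkState.unmarked, Finset.mem_sdiff, Finset.mem_insert]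
    tauto
  · simp [MarkState.unmarked]

/-- The potential that is released, or the charge that is paid, at a miss. -/
theorem erase_add_le_potential {k b : ℕ} {ψ : ℕ → ℕ → ℝ≥0∞} {K C : ℝ≥0∞}
    (hψ : StepBounds U k b ψ K C) {s : MarkState U} {prev : Finset U} {p : U} (L : List U)
    (hs : PhaseInvariant k prev s) (hp : p ∉ s.cache) :
    (∑ x ∈ (prev \ s.cache).erase p, chainTerm ψ (s.position x) (p :: L) s.unmarked x) +
        ψ (s.position p) (s.unmarked.filter (· ∈ L)).card ≤
      potential ψ s prev (p :: L) + K * ((if p ∈ prev then 0 else 1 : ℕ) : ℝ≥0∞) := by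
  unfold potential
  split_ifs with h
  · rw [← chainTerm_cons_self (ψ := ψ) (s.position p) L
      (show p ∉ s.unmarked from fun h => hp (Finset.sdiff_subset h)),
      Finset.sum_erase_add _ _ (Finset.mem_sdiff.2 ⟨h, hp⟩)]
    exact le_self_add
  · have h0 : s.position p = 0 := by
      by_contra h0
      exact h (hs.mem_prev p h0)
    rw [h0]
    refine add_le_add (Finset.sum_le_sum_of_subset (Finset.erase_subset _ _)) ?_
    rw [Nat.cast_one, mul_one]
    exact hψ.clean _ (((Finset.card_filter_le _ _).trans
      (Finset.card_le_card Finset.sdiff_subset)).trans hs.card_le)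

/-- At a new phase the cache is exactly the set of marked pages, which becomes the previous phase;
no page of it is missing, so the potential is `0`. The invariant makes the phases of the algorithm
those of `cleanCount`. -/
theorem exists_refresh_invariant {k : ℕ} {ψ : ℕ → ℕ → ℝ≥0∞} {s : MarkState U} {prev : Finset U}
    {p : U} (L : List U) (hs : PhaseInvariant k prev s) (hp : p ∉ s.cache) :
    ∃ prev₁, PhaseInvariant k prev₁ (refresh k s p) ∧
      cleanCount k prev s.marked (p :: L) = (if p ∈ prev₁ then 0 else 1) +
        cleanCount k prev₁ (insert p (refresh k s p).marked) L ∧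
      potential ψ (refresh k s p) prev₁ (p :: L) ≤ potential ψ s prev (p :: L) := by
  have hpm : p ∉ s.marked := fun h => hp (hs.marked_subset h)
  unfold refresh
  split_ifs with h
  · have heq : s.marked = s.cache := hs.marked_subset.antisymm h.2.2
    refine ⟨s.marked, ⟨Finset.empty_subset _, ?_, hs.card_le, fun x hx => absurd rfl hx⟩, ?_, ?_⟩
    · simp [heq]
    · have hk : k ≤ s.marked.card := heq ▸ h.2.1
      simp [cleanCount, hpm, hk]
    · simp [potential, heq]
  · refine ⟨prev, hs, ?_, le_rfl⟩
    have hk : ¬ k ≤ s.marked.card := by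
      intro hk
      have heq : s.marked = s.cache :=
        Finset.eq_of_subset_of_card_le hs.marked_subset (hs.card_le.trans hk)
      exact h ⟨hp, heq ▸ hk, heq.symm.subset⟩
    simp [cleanCount, hpm, hk]

theorem PhaseInvariant.replace_some {k : ℕ} {prev : Finset U} {s : MarkState U} {p v : U}
    (hs : PhaseInvariant k prev s) (hp : p ∉ s.cache) (hv : v ∈ s.unmarked) :
    PhaseInvariant k prev (s.replace p (some v)) := by
  obtain ⟨hvc, hvm⟩ := Finset.mem_sdiff.1 hv
  refine ⟨?_, ?_, (serves_replace_some hp hvc hs.card_le).2.2, ?_⟩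
  · refine Finset.insert_subset_insert _ fun x hx => Finset.mem_erase.2 ⟨?_, hs.marked_subset hx⟩
    rintro rfl
    exact hvm hx
  · change insert p (s.cache.erase v) ⊆ insert p s.marked ∪ prev
    rw [Finset.insert_union]
    exact Finset.insert_subset_insert _ ((Finset.erase_subset _ _).trans hs.cache_subset)
  · intro x hx
    by_cases hxv : x = v
    · subst hxv
      have := hs.cache_subset hvc
      simpa [hvm] using this
    · exact hs.mem_prev x (by simpa [MarkState.replace, hxv] using hx)

theorem PhaseInvariant.mark {k : ℕ} {prev : Finset U} {s : MarkState U} {p : U}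
    (hs : PhaseInvariant k prev s) (hc : (insert p s.cache).card ≤ k) :
    PhaseInvariant k prev ⟨insert p s.cache, insert p s.marked, s.position⟩ := by
  refine ⟨Finset.insert_subset_insert _ hs.marked_subset, ?_, hc, hs.mem_prev⟩
  change insert p s.cache ⊆ insert p s.marked ∪ prev
  rw [Finset.insert_union]
  exact Finset.insert_subset_insert _ hs.cache_subset

theorem eviction_bound {k b : ℕ} (hk : 0 < k) (hb : 0 < b) {ψ : ℕ → ℕ → ℝ≥0∞} {K C : ℝ≥0∞}
    (hψ : StepBounds U k b ψ K C) {s : MarkState U} {prev : Finset U} {p : U} (L : List U)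
    (pr : U → ℕ) (t : ℕ) (hs : PhaseInvariant k prev (refresh k s p)) (hp : p ∉ s.cache)
    (hc : k ≤ s.cache.card) :
    1 + expect (adaptiveQueries k b s p) (fun S => expect (adaptiveStep k s p S fun q => pr q)
        fun s' => potential ψ s' prev L) ≤
      (∑ x ∈ (prev \ (refresh k s p).cache).erase p,
        chainTerm ψ ((refresh k s p).position x) (p :: L) (refresh k s p).unmarked x) +
        ψ ((refresh k s p).position p) ((refresh k s p).unmarked.filter (· ∈ L)).card +
        C * expect (adaptiveQueries k b s p) fun S => (predError pr t L S : ℝ≥0∞) := by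
  have hW := unmarked_refresh_nonempty hk hp hc
  have hp₁ : p ∉ (refresh k s p).cache := by simpa using hp
  unfold adaptiveQueries adaptiveStep
  dsimp only
  simp only [if_neg hp, if_neg hc.not_gt]
  set s₁ := refresh k s p
  have hcard : s₁.unmarked.card ≤ k := (Finset.card_le_card Finset.sdiff_subset).trans hs.card_le
  set R := ∑ x ∈ (prev \ s₁.cache).erase p, chainTerm ψ (s₁.position x) (p :: L) s₁.unmarked x
  have hrep : ∀ X : Finset U, X.Nonempty → X ⊆ s₁.unmarked →
      expect ((sampleElement X).map (s₁.replace p)) (fun s' => potential ψ s' prev L) ≤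
        R + expect (sampleElement X) fun o =>
          o.elim 0 (chainTerm ψ (s₁.position p + 1) L s₁.unmarked) := by
    intro X hX hXW
    rw [expect_map, ← expect_const (sampleElement X) R, ← expect_add]
    refine expect_mono fun o ho => ?_
    obtain ⟨v, hv, rfl⟩ := exists_of_mem_support_sampleElement hX ho
    exact potential_replace_some_le hψ.mono L (Finset.sdiff_subset (hXW hv))
  by_cases hj : (s₁.position p : ℝ) ≤ Real.logb 2 k
  · rw [if_pos ⟨hp, hc, hj⟩]
    simp only [if_pos hj]
    calc 1 + expect (sampleSubset b s₁.unmarked) (fun S =>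
          expect ((sampleElement (furthest S fun q => pr q)).map (s₁.replace p))
            fun s' => potential ψ s' prev L)
        ≤ 1 + expect (sampleSubset b s₁.unmarked) (fun S => R +
            expect (sampleElement (furthest S fun q => pr q)) fun o =>
              o.elim 0 (chainTerm ψ (s₁.position p + 1) L s₁.unmarked)) := by
          refine add_le_add le_rfl (expect_mono fun S hS => hrep _ ?_ ?_)
          · exact furthest_nonempty (sample_nonempty hb hW hS) _
          · exact (furthest_subset _ _).trans (mem_support_sampleSubset.1 hS).1
      _ = R + (1 + expect (sampleSubset b s₁.unmarked) (fun S =>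
            expect (sampleElement (furthest S fun q => pr q)) fun o =>
              o.elim 0 (chainTerm ψ (s₁.position p + 1) L s₁.unmarked))) := by
          rw [expect_add, expect_const]
          ring
      _ ≤ _ := by
          rw [add_assoc R]
          exact add_le_add le_rfl (hψ.query _ _ L pr t hj hW hcard)
  · rw [if_neg fun h => hj h.2.2, expect_pure]
    simp only [if_neg hj]
    calc 1 + expect ((sampleElement s₁.unmarked).map (s₁.replace p))
          (fun s' => potential ψ s' prev L)
        ≤ 1 + (R + expect (sampleElement s₁.unmarked) fun o =>
              o.elim 0 (chainTerm ψ (s₁.position p + 1) L s₁.unmarked)) :=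
          add_le_add le_rfl (hrep _ hW subset_rfl)
      _ = R + (1 + expect (sampleElement s₁.unmarked) fun o =>
              o.elim 0 (chainTerm ψ (s₁.position p + 1) L s₁.unmarked)) := by ring
      _ ≤ R + ψ (s₁.position p) (s₁.unmarked.filter (· ∈ L)).card :=
          add_le_add le_rfl (hψ.random _ _ L hj hW hcard)
      _ ≤ _ := le_self_add

/-- The amortized inequality for one request. The sets `prev₁` and `marked₁` are chosen before the
random outcomes, so the clean count stays deterministic. -/
theorem step_bound {k b : ℕ} (hk : 0 < k) (hb : 0 < b) {ψ : ℕ → ℕ → ℝ≥0∞} {K C : ℝ≥0∞}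
    (hψ : StepBounds U k b ψ K C) {s : MarkState U} {prev : Finset U} (p : U) (L : List U)
    (pr : U → ℕ) (t : ℕ) (hs : PhaseInvariant k prev s) :
    ∃ prev₁ marked₁ : Finset U,
      (∀ S ∈ (adaptiveQueries k b s p).support,
        ∀ s' ∈ (adaptiveStep k s p S fun q => pr q).support,
          PhaseInvariant k prev₁ s' ∧ s'.marked = marked₁) ∧
      ((if p ∈ s.cache then 0 else 1 : ℕ) : ℝ≥0∞) +
          expect (adaptiveQueries k b s p) (fun S =>
            expect (adaptiveStep k s p S fun q => pr q) fun s' => potential ψ s' prev₁ L) +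
          K * (cleanCount k prev₁ marked₁ L : ℝ≥0∞) ≤
        potential ψ s prev (p :: L) + K * (cleanCount k prev s.marked (p :: L) : ℝ≥0∞) +
          C * expect (adaptiveQueries k b s p) fun S => (predError pr t L S : ℝ≥0∞) := by
  by_cases hp : p ∈ s.cache
  · have hins : insert p s.cache = s.cache := Finset.insert_eq_of_mem hp
    -- Written as a fetch that changes nothing, a hit is covered by `potential_mark_le`.
    have hstep : ∀ S : Finset U, adaptiveStep k s p S (fun q => pr q) =
        PMF.pure ⟨insert p s.cache, insert p s.marked, s.position⟩ := by
      intro S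
      unfold adaptiveStep
      dsimp only
      rw [if_pos hp, hins]
    refine ⟨prev, insert p s.marked, ?_, ?_⟩
    · intro S _ s' hs'
      rw [hstep, PMF.support_pure, Set.mem_singleton_iff] at hs'
      subst hs'
      exact ⟨hs.mark (by rw [hins]; exact hs.card_le), rfl⟩
    · simp only [hstep, expect_pure, expect_const, if_pos hp, Nat.cast_zero, zero_add]
      refine le_self_add.trans' (add_le_add ?_ ?_)
      · exact (potential_mark_le hψ.mono s prev p L).trans
          (Finset.sum_le_sum_of_subset (Finset.erase_subset _ _))
      · gcongr
        by_cases hpm : p ∈ s.marked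
        · simp [cleanCount, hpm]
        · have hcard : ¬ k ≤ s.marked.card := by
            intro h
            exact hpm (Finset.eq_of_subset_of_card_le hs.marked_subset (hs.card_le.trans h) ▸ hp)
          simp [cleanCount, hpm, hcard]
  obtain ⟨prev₁, hinv, hclean, hpot⟩ := exists_refresh_invariant (ψ := ψ) L hs hp
  have hp₁ : p ∉ (refresh k s p).cache := by simpa using hp
  have hrel := erase_add_le_potential hψ L hinv hp₁
  refine ⟨prev₁, insert p (refresh k s p).marked, ?_, ?_⟩
  · intro S hS s' hs'
    by_cases hc : s.cache.card < k
    · have href : refresh k s p = s := if_neg fun h => by omega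
      unfold adaptiveStep at hs'
      dsimp only at hs'
      rw [if_neg hp, if_pos hc, PMF.support_pure, Set.mem_singleton_iff] at hs'
      subst hs'
      rw [href] at hinv ⊢
      exact ⟨hinv.mark ((Finset.card_insert_le _ _).trans hc), rfl⟩
    · have hW := unmarked_refresh_nonempty hk hp (not_lt.1 hc)
      have : ∃ v ∈ (refresh k s p).unmarked, s' = (refresh k s p).replace p (some v) := by
        unfold adaptiveStep at hs'
        dsimp only at hs'
        rw [if_neg hp, if_neg hc] at hs'
        split_ifs at hs' with hj
        · obtain ⟨o, ho, rfl⟩ := (PMF.mem_support_map_iff _ _ _).1 hs'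
          unfold adaptiveQueries at hS
          dsimp only at hS
          rw [if_pos ⟨hp, not_lt.1 hc, hj⟩] at hS
          obtain ⟨v, hv, rfl⟩ := exists_of_mem_support_sampleElement
            (furthest_nonempty (sample_nonempty hb hW hS) _) ho
          exact ⟨v, (mem_support_sampleSubset.1 hS).1 (furthest_subset _ _ hv), rfl⟩
        · obtain ⟨o, ho, rfl⟩ := (PMF.mem_support_map_iff _ _ _).1 hs'
          obtain ⟨v, hv, rfl⟩ := exists_of_mem_support_sampleElement hW ho
          exact ⟨v, hv, rfl⟩
      obtain ⟨v, hv, rfl⟩ := this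
      exact ⟨hinv.replace_some hp₁ hv, rfl⟩
  · rw [hclean, if_neg hp, Nat.cast_add, mul_add]
    suffices h : 1 + expect (adaptiveQueries k b s p) (fun S =>
          expect (adaptiveStep k s p S fun q => pr q) fun s' => potential ψ s' prev₁ L) ≤
        potential ψ (refresh k s p) prev₁ (p :: L) +
          K * ((if p ∈ prev₁ then 0 else 1 : ℕ) : ℝ≥0∞) +
          C * expect (adaptiveQueries k b s p) fun S => (predError pr t L S : ℝ≥0∞) by
      calc _ ≤ (potential ψ (refresh k s p) prev₁ (p :: L) +
              K * ((if p ∈ prev₁ then 0 else 1 : ℕ) : ℝ≥0∞) +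
              C * expect (adaptiveQueries k b s p) fun S => (predError pr t L S : ℝ≥0∞)) +
              K * (cleanCount k prev₁ (insert p (refresh k s p).marked) L : ℝ≥0∞) :=
            add_le_add (by rw [Nat.cast_one]; exact h) le_rfl
        _ ≤ (potential ψ s prev (p :: L) +
              K * ((if p ∈ prev₁ then 0 else 1 : ℕ) : ℝ≥0∞) +
              C * expect (adaptiveQueries k b s p) fun S => (predError pr t L S : ℝ≥0∞)) +
              K * (cleanCount k prev₁ (insert p (refresh k s p).marked) L : ℝ≥0∞) := by gcongr
        _ = _ := by ring
    by_cases hc : s.cache.card < k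
    · have href : refresh k s p = s := if_neg fun h => by omega
      rw [href] at hrel ⊢
      have hstep : ∀ S : Finset U, adaptiveStep k s p S (fun q => pr q) =
          PMF.pure ⟨insert p s.cache, insert p s.marked, s.position⟩ := by
        intro S
        unfold adaptiveStep
        dsimp only
        rw [if_neg hp, if_pos hc]
        rfl
      simp only [hstep, expect_pure, expect_const]
      refine (hrel.trans' ?_).trans le_self_add
      rw [add_comm]
      exact add_le_add (potential_mark_le hψ.mono s prev₁ p L) (hψ.one_le _ _)
    · exact (eviction_bound hk hb hψ L pr t hinv hp (not_lt.1 hc)).trans (add_le_add hrel le_rfl)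

theorem expect_misses_cons (A : OnlineAlgorithm U) (τ : U → ℕ → ℕ) (t : ℕ) (s : A.State) (p : U)
    (L : List U) :
    expect (A.runFrom τ t s (p :: L)) (fun H => (misses H : ℝ≥0∞)) =
      ((if p ∈ A.cache s then 0 else 1 : ℕ) : ℝ≥0∞) +
        expect (A.queries s p) fun S => expect (A.step s p S fun q => τ q t) fun s' =>
          expect (A.runFrom τ (t + 1) s' L) fun H => (misses H : ℝ≥0∞) := by
  rw [expect_runFrom_cons]
  by_cases h : p ∈ A.cache s <;>
    simp only [misses, List.map_cons, List.sum_cons, Nat.cast_add, expect_add, if_pos, if_neg, h,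
      not_false_eq_true, expect_const]

theorem expect_queryError_cons (A : OnlineAlgorithm U) (τ : U → ℕ → ℕ) (t : ℕ) (s : A.State)
    (p : U) (L : List U) {Γ : List U} (hL : Γ.drop t = L) :
    expect (A.runFrom τ t s (p :: L)) (fun H => (queryError Γ τ H : ℝ≥0∞)) =
      expect (A.queries s p) (fun S => (predError (fun q => τ q t) t L S : ℝ≥0∞)) +
        expect (A.queries s p) fun S => expect (A.step s p S fun q => τ q t) fun s' =>
          expect (A.runFrom τ (t + 1) s' L) fun H => (queryError Γ τ H : ℝ≥0∞) := by
  rw [expect_runFrom_cons]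
  simp only [queryError, List.map_cons, List.sum_cons, Nat.cast_add, expect_add, expect_const,
    nextRequest, hL, predError]

theorem expect_misses_le {k b : ℕ} (hk : 0 < k) (hb : 0 < b) {ψ : ℕ → ℕ → ℝ≥0∞} {K C : ℝ≥0∞}
    (hψ : StepBounds U k b ψ K C) (τ : U → ℕ → ℕ) (Γ : List U) :
    ∀ (L : List U) (t : ℕ) (s : MarkState U) (prev : Finset U), Γ.drop t = L →
      PhaseInvariant k prev s →
      expect ((adaptiveQuery U k b).runFrom τ (t + 1) s L) (fun H => (misses H : ℝ≥0∞)) ≤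
        potential ψ s prev L + K * (cleanCount k prev s.marked L : ℝ≥0∞) +
          C * expect ((adaptiveQuery U k b).runFrom τ (t + 1) s L)
            (fun H => (queryError Γ τ H : ℝ≥0∞)) := by
  intro L
  induction L with
  | nil =>
    intro t s prev _ _
    simp [OnlineAlgorithm.runFrom, expect_pure, misses]
  | cons p L ih =>
    intro t s prev hL hs
    have hL' : Γ.drop (t + 1) = L := by rw [← List.tail_drop, hL, List.tail_cons]
    obtain ⟨prev₁, marked₁, hinv, hbound⟩ :=
      step_bound hk hb hψ p L (fun q => τ q (t + 1)) (t + 1) hs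
    set Q := adaptiveQueries k b s p
    set T : Finset U → PMF (MarkState U) := fun S => adaptiveStep k s p S fun q => τ q (t + 1)
    set E : MarkState U → ℝ≥0∞ := fun s' =>
      expect ((adaptiveQuery U k b).runFrom τ (t + 1 + 1) s' L) fun H => (queryError Γ τ H : ℝ≥0∞)
    have hmiss := expect_misses_cons (adaptiveQuery U k b) τ (t + 1) s p L
    have herr := expect_queryError_cons (adaptiveQuery U k b) τ (t + 1) s p L hL'
    refine hmiss.trans_le (le_of_le_of_eq ?_ (congrArg (_ + C * ·) herr.symm))
    calc _ ≤ ((if p ∈ s.cache then 0 else 1 : ℕ) : ℝ≥0∞) +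
          expect Q (fun S => expect (T S) fun s' => potential ψ s' prev₁ L +
            K * (cleanCount k prev₁ marked₁ L : ℝ≥0∞) + C * E s') := by
          refine add_le_add le_rfl (expect_mono fun S hS => expect_mono fun s' hs' => ?_)
          obtain ⟨h1, h2⟩ := hinv S hS s' hs'
          rw [← h2]
          exact ih (t + 1) s' prev₁ hL' h1
      _ = (((if p ∈ s.cache then 0 else 1 : ℕ) : ℝ≥0∞) +
            expect Q (fun S => expect (T S) fun s' => potential ψ s' prev₁ L) +
            K * (cleanCount k prev₁ marked₁ L : ℝ≥0∞)) +
            C * expect Q (fun S => expect (T S) E) := by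
          simp only [expect_add, expect_const, expect_mul_left]
          ring
      _ ≤ _ := by
          refine (add_le_add hbound le_rfl).trans_eq ?_
          rw [add_assoc, ← mul_add]
          rfl

theorem expect_run_misses_le {k b : ℕ} (hk : 0 < k) (hb : 0 < b) {ψ : ℕ → ℕ → ℝ≥0∞} {K C : ℝ≥0∞}
    (hψ : StepBounds U k b ψ K C) (τ : U → ℕ → ℕ) (Γ : List U) :
    expect ((adaptiveQuery U k b).run τ Γ) (fun H => (misses H : ℝ≥0∞)) ≤
      K * (2 * (opt k Γ : ℝ≥0∞)) +
        C * expect ((adaptiveQuery U k b).run τ Γ) (fun H => (queryError Γ τ H : ℝ≥0∞)) := by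
  have h := expect_misses_le hk hb hψ τ Γ Γ 0 ⟨∅, ∅, fun _ => 0⟩ ∅ rfl
    ⟨subset_rfl, by simp, by simp, fun x hx => absurd rfl hx⟩
  refine h.trans (add_le_add ?_ le_rfl)
  have : (cleanCount k ∅ ∅ Γ : ℝ≥0∞) ≤ 2 * (opt k Γ : ℝ≥0∞) := by
    exact_mod_cast cleanCount_le_two_mul_opt hk Γ
  simp only [potential, Finset.empty_sdiff, Finset.sum_empty, zero_add]
  gcongr

end Potential

/-! ### The two potentials and the final bounds -/

section Bounds

variable {U : Type u} [DecidableEq U]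

theorem expect_sampleSubset_gain_le {b : ℕ} (hb : 0 < b) {W : Finset U} (hW : W.Nonempty)
    (L : List U) :
    expect (sampleSubset b W) (fun S => ENNReal.ofReal (if S ⊆ W.filter (· ∈ L) then
        1 + gain b ((W.filter (· ∈ L)).filter fun u => ∀ x ∈ S, L.idxOf x < L.idxOf u).card
        else 0)) ≤
      ENNReal.ofReal (gain b (W.filter (· ∈ L)).card) := by
  have h0 : W.card.choose (min b W.card) ≠ 0 := (Nat.choose_pos (min_le_right _ _)).ne'
  rw [expect_sampleSubset, ← ENNReal.ofReal_sum_of_nonneg]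
  · refine (mul_le_mul_right (ENNReal.ofReal_le_ofReal
      (sum_sample_gain_le hb hW (Finset.filter_subset _ _) L.idxOf)) _).trans_eq ?_
    rw [ENNReal.ofReal_mul (Nat.cast_nonneg _), ENNReal.ofReal_natCast, ← mul_assoc,
      ENNReal.inv_mul_cancel (by exact_mod_cast h0) (ENNReal.natCast_ne_top _), one_mul]
  · intro S _
    have := gain_nonneg b ((W.filter (· ∈ L)).filter fun u => ∀ x ∈ S, L.idxOf x < L.idxOf u).card
    split_ifs <;> linarith

/-- A uniformly random page is the best of one sample, so the averaging bound applies with `b = 1`.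
-/
theorem expect_sampleElement_gain_le {W : Finset U} (hW : W.Nonempty) (L : List U) :
    expect (sampleElement W) (fun o => o.elim 0 fun v =>
        if v ∈ L then ENNReal.ofReal (1 + gain 1 (rank L W v)) else 0) ≤
      ENNReal.ofReal (gain 1 (W.filter (· ∈ L)).card) := by
  refine le_of_eq_of_le ?_ (expect_sampleSubset_gain_le one_pos hW L)
  rw [expect_sampleElement hW, expect_sampleSubset, min_eq_left hW.card_pos, Nat.choose_one_right,
    Finset.powersetCard_one, Finset.sum_map]
  congr 1
  refine Finset.sum_congr rfl fun v hv => ?_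
  simp only [Option.elim_some, Function.Embedding.coeFn_mk, Finset.singleton_subset_iff,
    Finset.mem_filter, hv, true_and, Finset.mem_singleton, forall_eq, Finset.filter_filter, rank]
  split_ifs <;> simp

theorem gain_one_le {k r : ℕ} (hr : r ≤ k) (hk : 0 < k) : gain 1 r ≤ 2 + Real.logb 2 k := by
  have h1 := gain_le 1 r
  have hk' : (1 : ℝ) ≤ k := by exact_mod_cast hk
  have hr' : (r : ℝ) ≤ k := by exact_mod_cast hr
  have h2 : Real.logb ((1 : ℕ) + 1) (1 + r) ≤ Real.logb 2 (2 * k) := by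
    norm_num only [Nat.cast_one]
    exact Real.logb_le_logb_of_le (by norm_num) (by positivity) (by linarith)
  rw [Real.logb_mul (by norm_num) (by positivity), Real.logb_self_eq_one (by norm_num)] at h2
  linarith

theorem gain_le_two_add_logb {b k : ℕ} (hb : 0 < b) (hk : 0 < k) {r : ℕ} (hr : r ≤ k) :
    gain b r ≤ 2 + Real.logb (b + 1) k := by
  have h1 := gain_le b r
  have hb1 := one_lt_cast_add_one hb
  have hb' : (1 : ℝ) ≤ b := by exact_mod_cast hb
  have hk' : (1 : ℝ) ≤ k := by exact_mod_cast hk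
  have hr' : (r : ℝ) ≤ k := by exact_mod_cast hr
  have h2 : Real.logb (b + 1) (1 + r) ≤ Real.logb (b + 1) ((b + 1) * k) :=
    Real.logb_le_logb_of_le hb1 (by positivity) (by nlinarith)
  rw [Real.logb_mul (by positivity) (by positivity), Real.logb_self_eq_one hb1] at h2
  linarith

/-- The potential behind the bound in terms of the prediction error: as long as a chain is short, it
saves up for the random evictions at its end. -/
noncomputable def learnedPotential (k b j r : ℕ) : ℝ≥0∞ :=
  if (j : ℝ) ≤ Real.logb 2 k then ENNReal.ofReal (3 * (1 + gain b r) + 2 * j)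
  else ENNReal.ofReal (1 + gain 1 r)

/-- The potential behind the bound that holds for arbitrary predictions. -/
noncomputable def robustPotential (k j r : ℕ) : ℝ≥0∞ :=
  if (j : ℝ) ≤ Real.logb 2 k then ENNReal.ofReal (4 + 2 * Real.logb 2 k - j)
  else ENNReal.ofReal (1 + gain 1 r)

theorem learnedPotential_le {k b j r : ℕ} (hk : 0 < k) (hr : r ≤ k) :
    learnedPotential k b j r ≤ ENNReal.ofReal (3 * (1 + gain b r) + 2 * j) := by
  unfold learnedPotential
  split_ifs with h
  · exact le_rfl
  -- After the switch the savings `2 * j` exceed `2 * log₂ k`, while the random part needs at most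
  -- `3 + log₂ k`.
  · have h1 := gain_one_le hr hk
    have h2 := gain_nonneg b r
    exact ENNReal.ofReal_le_ofReal (by linarith)

theorem rank_le_card (L : List U) (W : Finset U) (v : U) : rank L W v ≤ W.card :=
  Finset.card_filter_le _ _

theorem chainTerm_learnedPotential_le {k b : ℕ} (hk : 0 < k) (hb : 0 < b) (j t : ℕ)
    {W S : Finset U} {v : U} (L : List U) (pr : U → ℕ) (hW : W.card ≤ k) (hS : S ⊆ W)
    (hv : v ∈ furthest S fun q => pr q) :
    chainTerm (learnedPotential k b) j L W v ≤
      ENNReal.ofReal (2 * j) + 3 * ENNReal.ofReal (if S ⊆ W.filter (· ∈ L) then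
        1 + gain b ((W.filter (· ∈ L)).filter fun u => ∀ x ∈ S, L.idxOf x < L.idxOf u).card
        else 0) + 6 * (predError pr t L S : ℝ≥0∞) := by
  unfold chainTerm
  by_cases hvL : v ∈ L
  · rw [if_pos hvL]
    refine (learnedPotential_le hk ((rank_le_card L W v).trans hW)).trans ?_
    have h := one_add_gain_rank_le hb (t := t) hS hvL hv
    set X : ℝ := if S ⊆ W.filter (· ∈ L) then
        1 + gain b ((W.filter (· ∈ L)).filter fun u => ∀ x ∈ S, L.idxOf x < L.idxOf u).card
        else 0 with hX
    have hX0 : 0 ≤ X := by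
      have := gain_nonneg b
        ((W.filter (· ∈ L)).filter fun u => ∀ x ∈ S, L.idxOf x < L.idxOf u).card
      rw [hX]
      split_ifs <;> linarith
    have h3 : (3 : ℝ≥0∞) = ENNReal.ofReal 3 := by simp
    have h6 : (6 : ℝ≥0∞) = ENNReal.ofReal 6 := by simp
    rw [h3, h6, ← ENNReal.ofReal_natCast (predError pr t L S), ← ENNReal.ofReal_mul (by norm_num),
      ← ENNReal.ofReal_mul (by norm_num), ← ENNReal.ofReal_add (by positivity) (by positivity),
      ← ENNReal.ofReal_add (by positivity) (by positivity)]
    exact ENNReal.ofReal_le_ofReal (by linarith)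
  · rw [if_neg hvL]
    exact zero_le

theorem one_le_ofReal_one_add_gain (b r : ℕ) : 1 ≤ ENNReal.ofReal (1 + gain b r) := by
  have := gain_nonneg b r
  exact ENNReal.one_le_ofReal.2 (by linarith)

theorem random_step_bound {ψ : ℕ → ℕ → ℝ≥0∞} {j : ℕ} {W : Finset U} (L : List U)
    (hW : W.Nonempty) (hj : ∀ r, ψ j r = ENNReal.ofReal (1 + gain 1 r))
    (hj' : ∀ r, ψ (j + 1) r = ENNReal.ofReal (1 + gain 1 r)) :
    1 + expect (sampleElement W) (fun o => o.elim 0 (chainTerm ψ (j + 1) L W)) ≤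
      ψ j (W.filter (· ∈ L)).card := by
  have h := expect_sampleElement_gain_le hW L
  have hterm : chainTerm ψ (j + 1) L W =
      fun v => if v ∈ L then ENNReal.ofReal (1 + gain 1 (rank L W v)) else 0 := by
    ext v
    simp only [chainTerm, hj']
  rw [hterm, hj, ENNReal.ofReal_add zero_le_one (gain_nonneg _ _), ENNReal.ofReal_one]
  exact add_le_add le_rfl h

theorem learnedPotential_stepBounds {k b : ℕ} (hk : 0 < k) (hb : 0 < b) :
    StepBounds U k b (learnedPotential k b)
      (ENNReal.ofReal (9 * (1 + Real.logb (b + 1) k))) 6 where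
  mono j r r' h := by
    unfold learnedPotential
    split_ifs
    · have := gain_mono hb h
      exact ENNReal.ofReal_le_ofReal (by linarith)
    · have := gain_mono one_pos h
      exact ENNReal.ofReal_le_ofReal (by linarith)
  one_le j r := by
    unfold learnedPotential
    split_ifs
    · have := gain_nonneg b r
      have : (0 : ℝ) ≤ j := Nat.cast_nonneg j
      exact ENNReal.one_le_ofReal.2 (by linarith)
    · exact one_le_ofReal_one_add_gain 1 r
  clean r hr := by
    refine (learnedPotential_le hk hr).trans (ENNReal.ofReal_le_ofReal ?_)
    have h1 := gain_le_two_add_logb hb hk hr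
    have h2 : 0 ≤ Real.logb (b + 1) (k : ℝ) :=
      Real.logb_nonneg (one_lt_cast_add_one hb) (by exact_mod_cast hk)
    push_cast
    linarith
  query j W L pr t hj hW hWk := by
    have hg := gain_nonneg b (W.filter (· ∈ L)).card
    have hstep : expect (sampleSubset b W) (fun S =>
        expect (sampleElement (furthest S fun q => pr q)) fun o =>
          o.elim 0 (chainTerm (learnedPotential k b) (j + 1) L W)) ≤
        ENNReal.ofReal (2 * (j + 1 : ℕ)) +
          3 * ENNReal.ofReal (gain b (W.filter (· ∈ L)).card) +
          6 * expect (sampleSubset b W) fun S => (predError pr t L S : ℝ≥0∞) := by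
      calc _ ≤ expect (sampleSubset b W) (fun S => ENNReal.ofReal (2 * (j + 1 : ℕ)) +
            3 * ENNReal.ofReal (if S ⊆ W.filter (· ∈ L) then 1 + gain b
              ((W.filter (· ∈ L)).filter fun u => ∀ x ∈ S, L.idxOf x < L.idxOf u).card else 0) +
            6 * (predError pr t L S : ℝ≥0∞)) := by
            refine expect_mono fun S hS => expect_le_of_forall fun o ho => ?_
            obtain ⟨v, hv, rfl⟩ := exists_of_mem_support_sampleElement
              (furthest_nonempty (sample_nonempty hb hW hS) _) ho
            exact chainTerm_learnedPotential_le hk hb (j + 1) t L pr hWk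
              (mem_support_sampleSubset.1 hS).1 hv
        _ ≤ _ := by
            simp only [expect_add, expect_const, expect_mul_left]
            gcongr
            exact expect_sampleSubset_gain_le hb hW L
    refine (add_le_add le_rfl hstep).trans ?_
    rw [← add_assoc, learnedPotential, if_pos hj]
    refine add_le_add ?_ le_rfl
    have h3 : (3 : ℝ≥0∞) = ENNReal.ofReal 3 := by simp
    rw [h3, ← ENNReal.ofReal_one, ← ENNReal.ofReal_mul (by norm_num),
      ← ENNReal.ofReal_add (by positivity) (by positivity),
      ← ENNReal.ofReal_add (by positivity) (by positivity)]
    -- An equality: of the `3` units released, one pays for the miss and two are saved in `2 * (j +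
    -- 1)`.
    refine ENNReal.ofReal_le_ofReal ?_
    push_cast
    linarith
  random j W L hj hW _ :=
    random_step_bound L hW (fun r => if_neg hj) fun r => if_neg fun h => hj (by
      push_cast at h
      linarith)

theorem robustPotential_stepBounds {k b : ℕ} (hk : 0 < k) (hb : 0 < b) :
    StepBounds U k b (robustPotential k) (ENNReal.ofReal (4 * (1 + Real.logb 2 k))) 0 where
  mono j r r' h := by
    unfold robustPotential
    split_ifs
    · exact le_rfl
    · have := gain_mono one_pos h
      exact ENNReal.ofReal_le_ofReal (by linarith)
  one_le j r := by
    unfold robustPotential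
    split_ifs with h
    · have : (0 : ℝ) ≤ j := Nat.cast_nonneg j
      exact ENNReal.one_le_ofReal.2 (by linarith)
    · exact one_le_ofReal_one_add_gain 1 r
  clean r hr := by
    have h2 : 0 ≤ Real.logb 2 (k : ℝ) := Real.logb_nonneg (by norm_num) (by exact_mod_cast hk)
    rw [robustPotential, Nat.cast_zero, if_pos h2]
    exact ENNReal.ofReal_le_ofReal (by linarith)
  query j W L pr t hj hW hWk := by
    have hj0 : (0 : ℝ) ≤ j := Nat.cast_nonneg j
    have hstep : expect (sampleSubset b W) (fun S =>
        expect (sampleElement (furthest S fun q => pr q)) fun o =>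
          o.elim 0 (chainTerm (robustPotential k) (j + 1) L W)) ≤
        ENNReal.ofReal (3 + 2 * Real.logb 2 k - j) := by
      refine expect_le_of_forall fun S hS => expect_le_of_forall fun o ho => ?_
      obtain ⟨v, hv, rfl⟩ := exists_of_mem_support_sampleElement
        (furthest_nonempty (sample_nonempty hb hW hS) _) ho
      simp only [Option.elim_some, chainTerm, robustPotential]
      split_ifs
      · refine ENNReal.ofReal_le_ofReal ?_
        push_cast
        linarith
      -- At the switch `j ≤ log₂ k` still holds for the old position, so at least `3 + log₂ k` is
      -- left for the random part.
      · have := gain_one_le ((rank_le_card L W v).trans hWk) hk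
        exact ENNReal.ofReal_le_ofReal (by linarith)
      · exact zero_le
    refine ((add_le_add le_rfl hstep).trans_eq ?_).trans le_self_add
    rw [robustPotential, if_pos hj, ← ENNReal.ofReal_one,
      ← ENNReal.ofReal_add zero_le_one (by linarith)]
    congr 1
    ring
  random j W L hj hW _ :=
    random_step_bound L hW (fun r => if_neg hj) fun r => if_neg fun h => hj (by
      push_cast at h
      linarith)

theorem opt_pos {k : ℕ} (hk : 0 < k) {Γ : List U} (hΓ : Γ ≠ []) : 0 < opt k Γ := by
  obtain ⟨p, L, rfl⟩ := List.exists_cons_of_ne_nil hΓ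
  have h1 := cleanCount_cons_pos k p L
  have h2 := cleanCount_le_two_mul_opt hk (p :: L)
  omega

theorem expectedCost_le_learned {k b : ℕ} (hk : 0 < k) (hb : 0 < b)
    (μ : MeasureTheory.Measure (U → ℕ → ℕ)) [MeasureTheory.IsProbabilityMeasure μ] (Γ : List U) :
    (adaptiveQuery U k b).expectedCost μ Γ ≤
      ENNReal.ofReal (9 * (1 + Real.logb (b + 1) k)) * (2 * (opt k Γ : ℝ≥0∞)) +
        6 * (adaptiveQuery U k b).expectedError μ Γ := by
  unfold OnlineAlgorithm.expectedCost OnlineAlgorithm.expectedError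
  -- This form asks only that the constant be finite, so the expected error need not be measurable
  -- in `τ`.
  rw [← MeasureTheory.lintegral_const_mul' _ _ (by norm_num)]
  refine (MeasureTheory.lintegral_mono fun τ =>
    expect_run_misses_le hk hb (learnedPotential_stepBounds hk hb) τ Γ).trans_eq ?_
  rw [MeasureTheory.lintegral_add_left measurable_const, MeasureTheory.lintegral_const,
    MeasureTheory.measure_univ, mul_one]

theorem expectedCost_le_robust {k b : ℕ} (hk : 0 < k) (hb : 0 < b)
    (μ : MeasureTheory.Measure (U → ℕ → ℕ)) [MeasureTheory.IsProbabilityMeasure μ] (Γ : List U) :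
    (adaptiveQuery U k b).expectedCost μ Γ ≤
      ENNReal.ofReal (4 * (1 + Real.logb 2 k)) * (2 * (opt k Γ : ℝ≥0∞)) := by
  unfold OnlineAlgorithm.expectedCost
  refine (MeasureTheory.lintegral_mono fun τ =>
    expect_run_misses_le hk hb (robustPotential_stepBounds hk hb) τ Γ).trans_eq ?_
  simp

end Bounds

end Caching

theorem mainTheorem1 :
    ∃ c : ℝ, 0 < c ∧
      ∀ (U : Type u) [DecidableEq U] (k b : ℕ), 0 < k → 0 < b →
        (Caching.adaptiveQuery U k b).IsFeasible k ∧
        (Caching.adaptiveQuery U k b).QueriesAtMost b ∧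
        ∀ (μ : MeasureTheory.Measure (U → ℕ → ℕ)) [MeasureTheory.IsProbabilityMeasure μ]
          (Γ : List U),
          (Caching.adaptiveQuery U k b).expectedCost μ Γ ≤
            ENNReal.ofReal c *
              min (1 + ENNReal.ofReal (Real.logb (b + 1) k) +
                  (Caching.adaptiveQuery U k b).expectedError μ Γ / (Caching.opt k Γ : ℝ≥0∞))
                (1 + ENNReal.ofReal (Real.logb 2 k)) *
              (Caching.opt k Γ : ℝ≥0∞) := by
  -- The constant is `9` per clean request times `2` clean requests per offline miss; the robust
  -- bound needs only `4 * 2`.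
  refine ⟨18, by norm_num, fun U _ k b hk hb => ⟨Caching.adaptiveQuery_isFeasible hk hb,
    Caching.adaptiveQuery_queriesAtMost k b, fun μ _ Γ => ?_⟩⟩
  rcases eq_or_ne Γ [] with rfl | hΓ
  · have : (Caching.adaptiveQuery U k b).expectedCost μ [] = 0 := by
      simp [Caching.OnlineAlgorithm.expectedCost, Caching.OnlineAlgorithm.run,
        Caching.OnlineAlgorithm.runFrom, Caching.expect_pure, Caching.misses]
    rw [this]
    exact zero_le
  have hopt : (Caching.opt k Γ : ℝ≥0∞) ≠ 0 := by
    exact_mod_cast (Caching.opt_pos hk hΓ).ne'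
  have hk1 : (1 : ℝ) ≤ k := by exact_mod_cast hk
  have h1 : 0 ≤ Real.logb (b + 1) (k : ℝ) :=
    Real.logb_nonneg (Caching.one_lt_cast_add_one hb) hk1
  have h2 : 0 ≤ Real.logb 2 (k : ℝ) := Real.logb_nonneg (by norm_num) hk1
  have hc : ENNReal.ofReal 18 = 18 := by simp
  rw [hc]
  rcases min_choice (1 + ENNReal.ofReal (Real.logb (b + 1) k) +
      (Caching.adaptiveQuery U k b).expectedError μ Γ / (Caching.opt k Γ : ℝ≥0∞))
      (1 + ENNReal.ofReal (Real.logb 2 k)) with h | h <;> rw [h]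
  · refine (Caching.expectedCost_le_learned hk hb μ Γ).trans ?_
    rw [ENNReal.ofReal_mul (by norm_num), ENNReal.ofReal_add zero_le_one h1, ENNReal.ofReal_one,
      mul_assoc 18, add_mul _ (_ / _), ENNReal.div_mul_cancel hopt (ENNReal.natCast_ne_top _),
      mul_add 18]
    refine add_le_add (le_of_eq ?_) (mul_le_mul_left (by norm_num) _)
    rw [show ENNReal.ofReal 9 = 9 by simp]
    ring
  · refine (Caching.expectedCost_le_robust hk hb μ Γ).trans ?_
    rw [ENNReal.ofReal_mul (by norm_num), ENNReal.ofReal_add zero_le_one h2, ENNReal.ofReal_one,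
      show ENNReal.ofReal 4 = 4 by simp]
    calc 4 * (1 + ENNReal.ofReal (Real.logb 2 k)) * (2 * (Caching.opt k Γ : ℝ≥0∞))
        = 8 * (1 + ENNReal.ofReal (Real.logb 2 k)) * (Caching.opt k Γ : ℝ≥0∞) := by ring
      _ ≤ _ := by gcongr; norm_num
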